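/- **Setting.** Let $\mathbb T=\mathbb R\cup\{-\infty\}$ be the tropical semiring with $\boxplus=\max$ (identity $-\infty$) and $\boxtimes=+$ (identity $0$). The *standard planar network* $\Pi_{\rm st}$ of rank $n$ is oriented from left to right and consists of $n$ horizontal lines, numbered $1,\dots,n$ from bottom to top, each going from a source to a sink with the same number, and of a slanted edge $(l,i)$ going down from line $l$ to line $l-1$ for all $1\le i<l\le n$. On line $l<n$ one meets, from left to right: the source, the end of $(l+1,1)$, the beginning of $(l,1)$, the end of $(l+1,2)$, the beginning of $(l,2)$, …, the beginning of $(l,l-1)$, the end of $(l+1,l)$, the sink; on line $n$ one meets the source, the beginnings of $(n,1),\dots,(n,n-1)$, and the sink. The *essential* edges are the slanted edges and the $n$ edges adjacent to the sinks. $W_{\mathbb T}(\Pi_{\rm st})$ is the set of weightings $w:\mathrm{edge}(\Pi_{\rm st})\to\mathbb T$ that equal $0$ (the identity of $\boxtimes$) on all edges that are not essential. Write $a_{l,l}(w)$ for the weight of the edge adjacent to the sink $l$. An *$\alpha$-multipath* in a network is a collection of $\alpha$ pairwise vertex-disjoint oriented paths from sources to sinks; its weight is the sum of the weights of its edges. For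 $0\le i\le l\le n$ let $\alpha_i^{(l)}$ be the unique $i$-multipath in $\Pi_{\rm st}$ with sources $[l-i+1,l]$ and sinks $[1,i]$, and let $\mathcal A(w)=(m_i^{(l)})_{0\le i\le l\le n}$, $m_i^{(l)}=w(\alpha_i^{(l)})$ (so $m_0^{(l)}=0$). The weighting $w$ is *Gelfand–Zeitlin* if $\mathcal A(w)\in\Delta_{GZ}$, that is, for all $0<i\le l\le n-1$, $$m_i^{(l+1)}+m_{i-1}^{(l)}\ \ge\ m_{i-1}^{(l+1)}+m_i^{(l)},\qquad m_i^{(l+1)}+m_i^{(l)}\ \ge\ m_{i+1}^{(l+1)}+m_{i-1}^{(l)} .$$ The concatenation $\Pi_1\circ\dots\circ\Pi_k$ of networks of rank $n$ is obtained by identifying the sinks of $\Pi_t$ with the sources of $\Pi_{t+1}$ that have the same number; the edges keep their weights. For $\underline\alpha=(\alpha_1,\dots,\alpha_k)\in\mathbb Z_{\ge0}^k$, an *$\underline\alpha$-multipath* in it is a tuple $(p_1,\dots,p_k)$ of pairwise vertex-disjoint multipaths, where $p_t$ is an $\alpha_t$-multipath in $\Pi_1\circ\dots\circ\Pi_t$;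 its weight is the sum of the weights of the $p_t$. The weighted network $(\Pi_1\circ\dots\circ\Pi_k,w_1\circ\dots\circ w_k)$ satisfies the *multi-Gelfand–Zeitlin condition* if for every $\underline\alpha$ with $\sum_t\alpha_t\le n$ there is an $\underline\alpha$-multipath of maximal weight (among all $\underline\alpha$-multipaths) whose set of sources is $[n-\sum_t\alpha_t+1,n]$ and such that the set of sinks of $p_t$ is $[1,\alpha_t]$ for every $t$. **Lemma.** Let $\Pi_1=\dots=\Pi_k=\Pi_{\rm st}$, and let $w_1,\dots,w_k\in W_{\mathbb T}(\Pi_{\rm st})$ be Gelfand–Zeitlin. Assume that for all $t$ and all $1\le l<n$, if $a_{l,l}(w_t)=-\infty$ then $a_{l+1,l+1}(w_t)=-\infty$ (this holds in particular if the weights $w_t$ are real-valued). Then for all $1\le i\le j\le k$ the weighted network $(\Pi_i\circ\dots\circ\Pi_j,\ w_i\circ\dots\circ w_j)$ satisfies the multi-Gelfand–Zeitlin condition. -/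

import Mathlib

/-- The tropical numbers `ℝ ∪ {-∞}`. The tropical product is `+` (with identity `0` and
`⊥ + x = ⊥`), the tropical sum is `max` (with identity `⊥ = -∞`). -/
abbrev TropNum : Type := WithBot ℝ

/-- The combinatorial data of a planar network of rank `n`: a graph whose edges are oriented (from
left to right), with `n` sources and `n` sinks. The source (sink) that is usually labelled
`a ∈ {1, …, n}`, counted from bottom to top, is the one indexed by the element `a - 1` of
`Fin n`. -/
structure Network (n : ℕ) where
  V : Type
  E : Type
  src : E → V
  tgt : E → V
  source : Fin n → V
  sink : Fin n → V

namespace Network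

variable {n k : ℕ}

/-- `es` is the list of consecutive edges of an oriented path from `u` to `v`. -/
def IsWalk (N : Network n) : N.V → List N.E → N.V → Prop
  | u, [], v => u = v
  | u, e :: es, v => N.src e = u ∧ N.IsWalk (N.tgt e) es v

/-- An oriented path from a source of `N` to a sink of `N`. -/
structure Path (N : Network n) where
  first : Fin n
  last : Fin n
  edges : List N.E
  isWalk : N.IsWalk (N.source first) edges (N.sink last)

/-- The vertices through which a path runs (its two end points included). -/
def Path.verts {N : Network n} (p : N.Path) : Set N.V :=
  {v | v = N.source p.first ∨ ∃ e ∈ p.edges, v = N.tgt e}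

/-- The weight of a path: the tropical product of the weights of its edges. -/
def Path.weight {N : Network n} (w : N.E → TropNum) (p : N.Path) : TropNum :=
  (p.edges.map w).sum

/-- An `a`-multipath: `a` pairwise non-intersecting paths from sources to sinks. -/
structure Multipath (N : Network n) (a : ℕ) where
  path : Fin a → N.Path
  disj : ∀ r s, r ≠ s → Disjoint (path r).verts (path s).verts

namespace Multipath

variable {N : Network n} {a : ℕ}

def sources (p : N.Multipath a) : Set (Fin n) := Set.range fun r => (p.path r).first

def sinks (p : N.Multipath a) : Set (Fin n) := Set.range fun r => (p.path r).last

def verts (p : N.Multipath a) : Set N.V := ⋃ r, (p.path r).verts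

def weight (w : N.E → TropNum) (p : N.Multipath a) : TropNum := ∑ r, (p.path r).weight w

end Multipath

/-! Concatenation of networks `N 0, N 1, …, N k`. -/

/-- The identifications made in a concatenation: the sinks of each network are glued to the
sources of the next one. -/
inductive Glue (N : Fin (k + 1) → Network n) :
    (Σ t, (N t).V) → (Σ t, (N t).V) → Prop
  | glue (t : Fin k) (a : Fin n) :
      Glue N ⟨t.castSucc, (N t.castSucc).sink a⟩ ⟨t.succ, (N t.succ).source a⟩

/-- The vertices of the concatenation `N 0 ∘ ⋯ ∘ N k`: the disjoint union of the vertices of the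
`N t`, modulo the above identifications. -/
def ConcatV (N : Fin (k + 1) → Network n) : Type := Quot (Glue N)

/-- The concatenation `N 0 ∘ ⋯ ∘ N i` of the first networks, as a part of the concatenation
`N 0 ∘ ⋯ ∘ N k` of all of them: the edges are those of `N 0, …, N i`, and the sinks are those of
`N i`. For convenience the vertices of all the `N t` are kept, so that paths in different initial
parts live on the same set of vertices. For `i = Fin.last k` this is `N 0 ∘ ⋯ ∘ N k` itself. -/
def concatUpTo (N : Fin (k + 1) → Network n) (i : Fin (k + 1)) : Network n where
  V := ConcatV N
  E := {e : Σ t, (N t).E // e.1 ≤ i}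
  src e := Quot.mk _ ⟨e.1.1, (N e.1.1).src e.1.2⟩
  tgt e := Quot.mk _ ⟨e.1.1, (N e.1.1).tgt e.1.2⟩
  source a := Quot.mk _ ⟨0, (N 0).source a⟩
  sink a := Quot.mk _ ⟨i, (N i).sink a⟩

/-- The weighting `w 0 ∘ ⋯ ∘ w i` of `N 0 ∘ ⋯ ∘ N i`. -/
def concatWeight (N : Fin (k + 1) → Network n) (w : ∀ t, (N t).E → TropNum) (i : Fin (k + 1)) :
    (concatUpTo N i).E → TropNum :=
  fun e => w e.1.1 e.1.2

/-- The vertices of a multipath of `N 0 ∘ ⋯ ∘ N i`, as vertices of `N 0 ∘ ⋯ ∘ N k`. -/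
def concatVerts {N : Fin (k + 1) → Network n} {i : Fin (k + 1)} {a : ℕ}
    (p : (concatUpTo N i).Multipath a) : Set (ConcatV N) :=
  p.verts

/-- For `α = (α 0, …, α k)`, an `α`-multipath in `N 0 ∘ ⋯ ∘ N k`: for each `i` an `α i`-multipath
in `N 0 ∘ ⋯ ∘ N i`, these multipaths being pairwise non-intersecting. -/
structure TupleMultipath (N : Fin (k + 1) → Network n) (α : Fin (k + 1) → ℕ) where
  part : ∀ i, (concatUpTo N i).Multipath (α i)
  disj : ∀ i j, i ≠ j → Disjoint (concatVerts (part i)) (concatVerts (part j))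

def TupleMultipath.weight {N : Fin (k + 1) → Network n} {α : Fin (k + 1) → ℕ}
    (w : ∀ t, (N t).E → TropNum) (p : TupleMultipath N α) : TropNum :=
  ∑ i, (p.part i).weight (concatWeight N w i)

/-- The set of all sources of an `α`-multipath. -/
def TupleMultipath.sources {N : Fin (k + 1) → Network n} {α : Fin (k + 1) → ℕ}
    (p : TupleMultipath N α) : Set (Fin n) :=
  ⋃ i, (p.part i).sources

/-- The multi-Gelfand–Zeitlin condition for the weighting `w 0 ∘ ⋯ ∘ w k` of the composite network
`N 0 ∘ ⋯ ∘ N k`: for every `α` with `∑ α i ≤ n` there is an `α`-multipath with sources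
`[n - ∑ α i + 1, n]` and with sinks `[1, α i]` for each `i`, whose weight is maximal among the
weights of all `α`-multipaths. (The label of `a : Fin n` is `a + 1`. For `∑ α i > n` there are no
`α`-multipaths.) -/
def MultiGZ (N : Fin (k + 1) → Network n) (w : ∀ t, (N t).E → TropNum) : Prop :=
  ∀ α : Fin (k + 1) → ℕ, ∑ i, α i ≤ n →
    ∃ p : TupleMultipath N α,
      p.sources = {a : Fin n | n - ∑ i, α i + 1 ≤ (a : ℕ) + 1} ∧
      (∀ i, (p.part i).sinks = {a : Fin n | (a : ℕ) + 1 ≤ α i}) ∧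
      ∀ q : TupleMultipath N α, q.weight w ≤ p.weight w

end Network

/-! The standard network of rank `n`. It consists of horizontal lines `1, …, n` (from bottom to top)
and of a slanted edge `(l, i)` from line `l` to line `l - 1` for each `1 ≤ i < l ≤ n`. On each line
`l`, from left to right, one meets: the source; the end of `(l + 1, 1)`; the beginning of `(l, 1)`;
the end of `(l + 1, 2)`; the beginning of `(l, 2)`; …; the beginning of `(l, l - 1)`; the end of
`(l + 1, l)`; the sink. On the top line `n` there are no ends of slanted edges. -/

/-- Vertices of the standard network. On line `l`, the source is at `x = 0`, the end of the slanted
edge `(l + 1, i)` at `x = 2 * i - 1`, the beginning of `(l, i)` at `x = 2 * i`, and the sink at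
`x = 2 * l`. So `x` gives the order of the vertices of a line; on line `n` only even `x` occur. -/
@[ext]
structure StdV (n : ℕ) where
  l : ℕ
  x : ℕ
  one_le : 1 ≤ l
  le_n : l ≤ n
  x_le : x ≤ 2 * l
  even_top : l = n → Even x

/-- The `x` of the vertex that follows the vertex `x` on line `l`. -/
def nextX (n l x : ℕ) : ℕ := if l = n then x + 2 else x + 1

/-- Edges of the standard network: the horizontal edges, each given by its left end, and the slanted
edges. -/
inductive StdE (n : ℕ) : Type
  | horiz (v : StdV n) (h : v.x < 2 * v.l)
  | slant (l i : ℕ) (hi : 1 ≤ i) (hil : i < l) (hl : l ≤ n)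

def StdE.src {n : ℕ} : StdE n → StdV n
  | .horiz v _ => v
  | .slant l i _ _ _ =>
      { l := l, x := 2 * i, one_le := by omega, le_n := by omega, x_le := by omega,
        even_top := fun _ => even_two_mul i }

def StdE.tgt {n : ℕ} : StdE n → StdV n
  | .horiz v h =>
      { l := v.l, x := nextX n v.l v.x, one_le := v.one_le, le_n := v.le_n
        x_le := by
          unfold nextX
          split_ifs with hn
          · obtain ⟨y, hy⟩ := v.even_top hn
            omega
          · omega
        even_top := fun hn => by
          have h1 := v.even_top hn
          simp only [nextX, if_pos hn]
          exact h1.add even_two }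
  | .slant l i _ _ _ =>
      { l := l - 1, x := 2 * i - 1, one_le := by omega, le_n := by omega, x_le := by omega,
        even_top := fun _ => by omega }

/-- The standard planar network of rank `n`. -/
abbrev stdNetwork (n : ℕ) : Network n where
  V := StdV n
  E := StdE n
  src := StdE.src
  tgt := StdE.tgt
  source a := ⟨a + 1, 0, by omega, by omega, by omega, fun _ => Even.zero⟩
  sink a := ⟨a + 1, 2 * (a + 1), by omega, by omega, by omega, fun _ => even_two_mul _⟩

/-- The edge on line `l` that is adjacent to the sink `l`. -/
def sinkEdge (n l : ℕ) (h1 : 1 ≤ l) (hl : l ≤ n) : StdE n :=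
  .horiz ⟨l, if l = n then 2 * l - 2 else 2 * l - 1, h1, hl, by split_ifs <;> omega,
    fun h => by rw [if_pos h]; exact ⟨l - 1, by omega⟩⟩ (by dsimp only; split_ifs <;> omega)

/-- The essential edges: the slanted ones and those adjacent to the sinks. -/
def StdE.IsEssential {n : ℕ} (e : StdE n) : Prop :=
  (∃ l i hi hil hl, e = .slant l i hi hil hl) ∨ ∃ l h1 hl, e = sinkEdge n l h1 hl

/-- The set `W(Π_st)` of the weightings of the standard network that are trivial (equal to the
identity `0` of the tropical product) outside of the essential edges. -/
def stdWeightings (n : ℕ) : Set ((stdNetwork n).E → TropNum) :=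
  {w | ∀ e : StdE n, ¬ e.IsEssential → w e = 0}

/-- The horizontal edges of line `l`, from left to right, from the vertex `x` on, as long as they
do not go beyond `x = y`. -/
def lineEdges (n l y : ℕ) (h1 : 1 ≤ l) (hl : l ≤ n) (hy : y ≤ 2 * l) (x : ℕ)
    (hx : l = n → Even x) : List (StdE n) :=
  if h : nextX n l x ≤ y then
    .horiz ⟨l, x, h1, hl, by unfold nextX at h; split_ifs at h <;> omega, hx⟩
        (by unfold nextX at h; dsimp only; split_ifs at h <;> omega) ::
      lineEdges n l y h1 hl hy (nextX n l x) (fun hn => by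
        have h2 := hx hn
        simp only [nextX, if_pos hn]
        exact h2.add even_two)
  else []
termination_by y - x
decreasing_by unfold nextX at h ⊢; split_ifs at h ⊢ <;> omega

/-- The staircase from `(j + d, 2 * j)` to the sink `j`: use the slanted edges
`(j + d, j), (j + d - 1, j), …, (j + 1, j)`. Each of them ends just before the next one begins. -/
def stairEdges (n j : ℕ) (hj : 1 ≤ j) : (d : ℕ) → j + d ≤ n → List (StdE n)
  | 0, _ => []
  | d + 1, h =>
      .slant (j + d + 1) j hj (by omega) h ::
        .horiz ⟨j + d, 2 * j - 1, by omega, by omega, by omega, fun _ => by omega⟩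
          (by dsimp only; omega) ::
        stairEdges n j hj d (by omega)

theorem isWalk_append {n : ℕ} (N : Network n) {u v z : N.V} {es fs : List N.E}
    (h1 : N.IsWalk u es v) (h2 : N.IsWalk v fs z) : N.IsWalk u (es ++ fs) z := by
  induction es generalizing u with
  | nil => cases h1; exact h2
  | cons e es ih => exact ⟨h1.1, ih h1.2⟩

theorem lineEdges_isWalk (n l y : ℕ) (h1 : 1 ≤ l) (hl : l ≤ n) (hy : y ≤ 2 * l)
    (hye : Even y) (x : ℕ) (hx : l = n → Even x) (hxy : x ≤ y) :
    (stdNetwork n).IsWalk (⟨l, x, h1, hl, by omega, hx⟩ : StdV n)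
      (lineEdges n l y h1 hl hy x hx) (⟨l, y, h1, hl, hy, fun _ => hye⟩ : StdV n) := by
  rw [lineEdges]
  split_ifs with h
  · refine ⟨rfl, ?_⟩
    have hlt : y - nextX n l x < y - x := by
      unfold nextX at h ⊢; split_ifs at h ⊢ <;> omega
    exact lineEdges_isWalk n l y h1 hl hy hye (nextX n l x) _ h
  · have hxe : x = y := by
      unfold nextX at h
      split_ifs at h with hn
      · obtain ⟨a, ha⟩ := hx hn
        obtain ⟨b, hb⟩ := hye
        omega
      · omega
    subst hxe
    rfl
termination_by y - x

theorem lineEdges_tgt (n l y : ℕ) (h1 : 1 ≤ l) (hl : l ≤ n) (hy : y ≤ 2 * l) (x : ℕ)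
    (hx : l = n → Even x) :
    ∀ e ∈ lineEdges n l y h1 hl hy x hx, e.tgt.l = l ∧ e.tgt.x ≤ y := by
  intro e he
  rw [lineEdges] at he
  split_ifs at he with h
  · rcases List.mem_cons.1 he with rfl | he
    · exact ⟨rfl, h⟩
    · have hlt : y - nextX n l x < y - x := by
        unfold nextX at h ⊢; split_ifs at h ⊢ <;> omega
      exact lineEdges_tgt n l y h1 hl hy _ _ e he
  · simp at he
termination_by y - x

theorem stairEdges_isWalk (n j : ℕ) (hj : 1 ≤ j) (d : ℕ) (h : j + d ≤ n) :
    (stdNetwork n).IsWalk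
      (⟨j + d, 2 * j, by omega, h, by omega, fun _ => even_two_mul j⟩ : StdV n)
      (stairEdges n j hj d h)
      (⟨j, 2 * j, hj, by omega, le_rfl, fun _ => even_two_mul j⟩ : StdV n) := by
  induction d with
  | zero => rfl
  | succ d ih =>
    refine ⟨rfl, rfl, ?_⟩
    have h2 : (StdE.horiz (⟨j + d, 2 * j - 1, by omega, by omega, by omega, fun _ => by omega⟩ :
        StdV n) (by dsimp only; omega)).tgt =
        ⟨j + d, 2 * j, by omega, by omega, by omega, fun _ => even_two_mul j⟩ := by
      ext
      · rfl
      · simp only [StdE.tgt, nextX]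
        split_ifs <;> omega
    have h3 := ih (by omega)
    rw [← h2] at h3
    exact h3

theorem stairEdges_tgt (n j : ℕ) (hj : 1 ≤ j) (d : ℕ) (h : j + d ≤ n) :
    ∀ e ∈ stairEdges n j hj d h,
      e.tgt.l < j + d ∧ 2 * j - 1 ≤ e.tgt.x ∧ e.tgt.x ≤ 2 * j := by
  induction d with
  | zero => intro e he; simp [stairEdges] at he
  | succ d ih =>
    intro e he
    rw [stairEdges] at he
    rcases List.mem_cons.1 he with rfl | he
    · simp only [StdE.tgt]
      omega
    rcases List.mem_cons.1 he with rfl | he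
    · simp only [StdE.tgt, nextX]
      split_ifs <;> omega
    · have h1 := ih (by omega) e he
      omega

/-- The path from the source `j + d` to the sink `j` that runs along line `j + d` up to `x = 2 * j`
and then down the staircase. -/
def stairPath (n j d : ℕ) (hj : 1 ≤ j) (h : j + d ≤ n) : (stdNetwork n).Path where
  first := ⟨j + d - 1, by omega⟩
  last := ⟨j - 1, by omega⟩
  edges := lineEdges n (j + d) (2 * j) (by omega) h (by omega) 0 (fun _ => Even.zero) ++
    stairEdges n j hj d h
  isWalk := by
    have h1 := lineEdges_isWalk n (j + d) (2 * j) (by omega) h (by omega) (even_two_mul j) 0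
      (fun _ => Even.zero) (by omega)
    have h2 := isWalk_append _ h1 (stairEdges_isWalk n j hj d h)
    have e1 : (stdNetwork n).source ⟨j + d - 1, by omega⟩ =
        (⟨j + d, 0, by omega, h, by omega, fun _ => Even.zero⟩ : StdV n) := by
      apply StdV.ext
      · change j + d - 1 + 1 = j + d
        omega
      · rfl
    have e2 : (stdNetwork n).sink ⟨j - 1, by omega⟩ =
        (⟨j, 2 * j, hj, by omega, le_rfl, fun _ => even_two_mul j⟩ : StdV n) := by
      apply StdV.ext
      · change j - 1 + 1 = j
        omega
      · change 2 * (j - 1 + 1) = 2 * j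
        omega
    rw [e1, e2]
    exact h2

theorem stairPath_verts (n j d : ℕ) (hj : 1 ≤ j) (h : j + d ≤ n) (v : StdV n)
    (hv : v ∈ (stairPath n j d hj h).verts) :
    (v.l = j + d ∧ v.x ≤ 2 * j) ∨ (v.l < j + d ∧ 2 * j - 1 ≤ v.x ∧ v.x ≤ 2 * j) := by
  rcases hv with rfl | ⟨e, he, rfl⟩
  · left
    constructor
    · change j + d - 1 + 1 = j + d
      omega
    · exact Nat.zero_le _
  · rcases List.mem_append.1 he with he | he
    · exact Or.inl (lineEdges_tgt _ _ _ _ _ _ _ _ e he)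
    · exact Or.inr (stairEdges_tgt _ _ _ _ _ e he)

/-- The multipath `α_i^{(l)}`, that is, the `i`-multipath of the standard network with sources
`[l - i + 1, l]` and sinks `[1, i]`: for `j = 1, …, i`, its `j`-th path goes from the source
`l - i + j` to the sink `j`. -/
def alphaMultipath (n i l : ℕ) (hil : i ≤ l) (hl : l ≤ n) : (stdNetwork n).Multipath i where
  path r := stairPath n (r + 1) (l - i) (by omega) (by omega)
  disj r s hrs := by
    have hne : (r : ℕ) ≠ s := fun h => hrs (Fin.ext h)
    rw [Set.disjoint_left]
    intro v hr hs
    have h1 := stairPath_verts _ _ _ _ _ v hr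
    have h2 := stairPath_verts _ _ _ _ _ v hs
    omega

theorem alphaMultipath_sources (n i l : ℕ) (hil : i ≤ l) (hl : l ≤ n) :
    (alphaMultipath n i l hil hl).sources =
      {a : Fin n | l - i + 1 ≤ (a : ℕ) + 1 ∧ (a : ℕ) + 1 ≤ l} := by
  ext a
  constructor
  · rintro ⟨r, rfl⟩
    change l - i + 1 ≤ (r : ℕ) + 1 + (l - i) - 1 + 1 ∧ (r : ℕ) + 1 + (l - i) - 1 + 1 ≤ l
    omega
  · rintro ⟨h1, h2⟩
    refine ⟨⟨(a : ℕ) - (l - i), by omega⟩, Fin.ext ?_⟩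
    change (a : ℕ) - (l - i) + 1 + (l - i) - 1 = a
    omega

theorem alphaMultipath_sinks (n i l : ℕ) (hil : i ≤ l) (hl : l ≤ n) :
    (alphaMultipath n i l hil hl).sinks = {a : Fin n | (a : ℕ) + 1 ≤ i} := by
  ext a
  constructor
  · rintro ⟨r, rfl⟩
    change (r : ℕ) + 1 - 1 + 1 ≤ i
    omega
  · intro h
    exact ⟨⟨a, h⟩, rfl⟩

/-- The tuple `𝒜(w) = (w(α_i^{(l)}))`, `0 ≤ i ≤ l ≤ n`; the entry of index `(i, l)` is
`stdA w i l`. (The values at other pairs `(i, l)` are irrelevant.) -/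
def stdA {n : ℕ} (w : (stdNetwork n).E → TropNum) (i l : ℕ) : TropNum :=
  if h : i ≤ l ∧ l ≤ n then (alphaMultipath n i l h.1 h.2).weight w else ⊥

/-- The Gelfand–Zeitlin cone: the tuples `m i l = m_i^{(l)}`, `0 ≤ i ≤ l ≤ n`, with `m_0^{(l)} = 0`
that satisfy the Gelfand–Zeitlin inequalities. Only entries with `0 ≤ i ≤ l ≤ n` are involved. -/
def gzCone (n : ℕ) : Set (ℕ → ℕ → TropNum) :=
  {m | (∀ l, l ≤ n → m 0 l = 0) ∧
    ∀ i l, 0 < i → i ≤ l → l + 1 ≤ n →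
      m (i - 1) (l + 1) + m i l ≤ m i (l + 1) + m (i - 1) l ∧
      m (i + 1) (l + 1) + m (i - 1) l ≤ m i (l + 1) + m i l}

/-- A weighting `w` of the standard network is Gelfand–Zeitlin if `𝒜(w)` lies in the
Gelfand–Zeitlin cone. -/
def IsGelfandZeitlin {n : ℕ} (w : (stdNetwork n).E → TropNum) : Prop := stdA w ∈ gzCone n

/-! A path is determined by the columns `c L` of the slanted edges by which it leaves the lines, the
edge adjacent to its sink `b` counting as column `b` on line `b`. On a line `L` that it visits, it
occupies the interval `[2 * c (L + 1) - 1, 2 * c L]`, the truncated subtraction giving the source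
`0` on the highest line. Disjointness and weight thus become statements about antitone functions.

Two moves on disjoint paths do not decrease the weight. A sink `u + 1` goes down to an unoccupied
sink `u` by truncating the columns at `u`: a piece of column `u + 1` is replaced by a piece of
column `u`, and the comparison is the second Gelfand–Zeitlin inequality (`routeWeight_sinkDown`). A
source `s` goes up to an unoccupied `s + 1` by pushing a chain of paths one column to the right
along a diagonal, and the comparison is the first inequality (`exists_sourceUp`). Isolating these
comparisons requires cancelling tropical terms; the condition on the sink weights ensures that these
terms are finite whenever the comparison is not trivial (`stdEntry_ne_bot`).

In a concatenation, the sink `u` below a final sink `u + 1` may be occupied by a path that continues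
into the next network. The two paths then exchange their initial parts, and the source of the
continuing one is moved up in the next network (`exists_swap`). Each move lowers `systemDefect`, and
when none applies, the sources are at the top and the sinks at the bottom (`exists_extremal`). Such
extremal systems have finitely many weights, so one of them is heaviest; since every system is
dominated by an extremal one, it is heaviest among all systems. -/

/-! Oriented paths of the standard network from line `a` to line `b`, encoded by the columns of
their slanted edges. -/

/-- The function `c` encodes a path from the source `a` to the sink `b`: for `b < L ≤ a` it leaves
the line `L` by the slanted edge `(L, c L)`. -/
structure IsRoute (n a b : ℕ) (c : ℕ → ℕ) : Prop where
  anti : Antitone c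
  low : ∀ L, L ≤ b → c L = b
  high : ∀ L, a < L → c L = 0
  pos : ∀ L, L ≤ a → 1 ≤ c L
  one_le : 1 ≤ b
  le : b ≤ a
  le_n : a ≤ n

namespace IsRoute

variable {n a b : ℕ} {c : ℕ → ℕ}

theorem le_low (h : IsRoute n a b c) (L : ℕ) : c L ≤ b := by
  rcases le_total L b with h1 | h1
  · exact (h.low L h1).le
  · exact (h.anti h1).trans (h.low b le_rfl).le

/-- Below the sink the column `b` exceeds `L`, and above the source the column is 0. The visited
lines can therefore be read off from `c` alone, which is why `RoutesDisjoint` does not mention end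
points. -/
theorem visits_iff (h : IsRoute n a b c) (L : ℕ) : (1 ≤ c L ∧ c L ≤ L) ↔ b ≤ L ∧ L ≤ a := by
  constructor
  · rintro ⟨h1, h2⟩
    constructor
    · by_contra h3
      have := h.low L (by omega)
      omega
    · by_contra h3
      have := h.high L (by omega)
      omega
  · rintro ⟨h1, h2⟩
    exact ⟨h.pos L h2, (h.le_low L).trans h1⟩

end IsRoute

/-- The paths encoded by `c` and `c'` do not intersect. -/
def RoutesDisjoint (c c' : ℕ → ℕ) : Prop :=
  ∀ L, 1 ≤ c L → c L ≤ L → 1 ≤ c' L → c' L ≤ L → c L < c' (L + 1) ∨ c' L < c (L + 1)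

theorem RoutesDisjoint.symm {c c' : ℕ → ℕ} (h : RoutesDisjoint c c') : RoutesDisjoint c' c :=
  fun L h1 h2 h3 h4 => (h L h3 h4 h1 h2).symm

/-- A path that is to the left of another one stays to the left of it further down. -/
theorem RoutesDisjoint.lt_of_le {n a b a' b' : ℕ} {c c' : ℕ → ℕ} (hs : RoutesDisjoint c c')
    (h : IsRoute n a b c) (h' : IsRoute n a' b' c') {M : ℕ} (hb : b ≤ M) (hb' : b' ≤ M) (d : ℕ)
    (hd : c (M + d) < c' (M + d + 1)) : c M < c' (M + 1) := by
  induction d generalizing M with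
  | zero => exact hd
  | succ d ih =>
    have h1 : c (M + 1) < c' (M + 1 + 1) := by
      apply ih (by omega) (by omega)
      rwa [show M + 1 + d = M + (d + 1) by omega]
    have h2 : M ≤ a' := by
      by_contra h2
      have := h'.high (M + 1 + 1) (by omega)
      omega
    have h3 : c' (M + 1 + 1) ≤ c' M := h'.anti (by omega)
    have v' := (h'.visits_iff M).2 ⟨hb', h2⟩
    -- The opposite order on line `M` would give `c' M < c (M + 1) < c' (M + 2)`, against
    -- monotonicity. Above the source of the first path its column is 0, which is smaller than `c'
    -- (M + 2)`.
    by_cases h4 : M ≤ a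
    · have v := (h.visits_iff M).2 ⟨hb, h4⟩
      rcases hs M v.1 v.2 v'.1 v'.2 with h5 | h5
      · exact h5
      · omega
    · have h5 := h.high M (by omega)
      have h6 : c' (M + 1 + 1) ≤ c' (M + 1) := h'.anti (by omega)
      omega

/-- The weight of the path encoded by `c`. -/
def routeWeight (A : ℕ → ℕ → TropNum) (n : ℕ) (c : ℕ → ℕ) : TropNum :=
  ∑ L ∈ Finset.Icc 1 n, A L (c L)

/-- The properties of the weights `A L i` of the essential edges that hold for Gelfand–Zeitlin
weightings; `A L L` is the weight of the edge adjacent to the sink `L`. -/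
structure GoodWeights (n : ℕ) (A : ℕ → ℕ → TropNum) : Prop where
  zero : ∀ L, A L 0 = 0
  big : ∀ L i, L < i → A L i = 0
  column : ∀ u M, 1 ≤ u → u + 1 ≤ M → M ≤ n →
    ∑ L ∈ Finset.Icc (u + 1) M, A L (u + 1) ≤ ∑ L ∈ Finset.Icc u M, A L u
  diagonal : ∀ s q, 1 ≤ s → 1 ≤ q → s + q ≤ n → A q q ≠ ⊥ →
    ∑ L ∈ Finset.Icc (s + 1) (s + q), A L (L - s - 1) ≤
      ∑ L ∈ Finset.Icc (s + 1) (s + q), A L (L - s)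
  ne_bot : ∀ q b, 1 ≤ q → q ≤ b → b ≤ n → A b b ≠ ⊥ → A q q ≠ ⊥

/-! ### Moving a sink down. -/

section SinkDown

variable {n a u : ℕ} {c : ℕ → ℕ}

theorem IsRoute.sinkDown (h : IsRoute n a (u + 1) c) (hu : 1 ≤ u) :
    IsRoute n a u (fun L => min (c L) u) where
  anti := fun x y hxy => min_le_min_right _ (h.anti hxy)
  low L hL := by
    have := h.low L (by omega)
    simp only [this]
    omega
  high L hL := by simp [h.high L hL]
  pos L hL := by
    have := h.pos L hL
    exact le_min this hu
  one_le := hu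
  le := by have := h.le; omega
  le_n := h.le_n

/-- Truncation moves the path to the left, so it could only hit a path on its left that uses column
`u`; such a path would have to end at the sink `u`. On the added line `u`, every other path has a
sink below `u` and so keeps to the left of column `u`. -/
theorem RoutesDisjoint.sinkDown {a' b' : ℕ} {c' : ℕ → ℕ} (h : IsRoute n a (u + 1) c) (hu : 1 ≤ u)
    (h' : IsRoute n a' b' c') (hs : RoutesDisjoint c c') (hb : b' ≠ u) :
    RoutesDisjoint (fun L => min (c L) u) c' := by
  intro L h1 h2 h3 h4
  have hr := h.sinkDown hu
  have v := (hr.visits_iff L).1 ⟨h1, h2⟩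
  have v' := (h'.visits_iff L).1 ⟨h3, h4⟩
  rcases Nat.lt_or_ge u L with hL | hL
  · have w := (h.visits_iff L).2 ⟨hL, v.2⟩
    rcases hs L w.1 w.2 h3 h4 with h5 | h5
    · left
      exact (min_le_left _ _).trans_lt h5
    · right
      have h6 := h.le_low (L + 1)
      -- A path on the left stays on the left down to its sink `b'`, where its column is `b'`; hence
      -- `b' ≤ u`. But `c' L = u` gives `u ≤ b'`.
      have h7 : c' L ≠ u := by
        intro h7
        have h8 := h'.le_low L
        obtain ⟨d, rfl⟩ := Nat.exists_eq_add_of_le v'.1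
        have h9 := hs.symm.lt_of_le h' h (M := b') le_rfl (by omega) d h5
        have h10 := h'.low b' le_rfl
        have h11 := h.le_low (b' + 1)
        omega
      exact lt_min h5 (by omega)
  · right
    have hLu : L = u := by omega
    subst hLu
    have h5 := h.low (L + 1) le_rfl
    have h6 := h'.le_low L
    have h7 : c' L < L := by omega
    simpa [h5] using h7

theorem routeWeight_sinkDown {A : ℕ → ℕ → TropNum} (hA : GoodWeights n A)
    (h : IsRoute n a (u + 1) c) (hu : 1 ≤ u) :
    routeWeight A n c ≤ routeWeight A n (fun L => min (c L) u) := by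
  classical
  have hex : ∃ M, c (M + 1) ≤ u := ⟨a, by rw [h.high _ (Nat.lt_succ_self a)]; omega⟩
  -- `M` is the highest line on which the column is `u + 1`; truncation changes nothing above it.
  obtain ⟨M, hM, hmin⟩ : ∃ M, c (M + 1) ≤ u ∧ ∀ L ≤ M, c L = u + 1 := by
    refine ⟨Nat.find hex, Nat.find_spec hex, fun L hL => ?_⟩
    rcases L with _ | L
    · exact h.low 0 (by omega)
    · have := Nat.find_min hex (m := L) (by omega)
      have := h.le_low (L + 1)
      omega
  have hu1 : u + 1 ≤ M := by
    by_contra h1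
    have := h.low (M + 1) (by omega)
    omega
  have hMn : M ≤ n := by
    by_contra h1
    have := h.high M (by have := h.le_n; omega)
    have := hmin M le_rfl
    omega
  have hup : ∀ L, M < L → c L ≤ u := fun L hL => (h.anti hL).trans hM
  have key := hA.column u M hu hu1 hMn
  have hsub : Finset.Icc 1 M ⊆ Finset.Icc 1 n := Finset.Icc_subset_Icc_right hMn
  unfold routeWeight
  rw [← Finset.sum_sdiff hsub, ← Finset.sum_sdiff hsub]
  refine add_le_add (le_of_eq (Finset.sum_congr rfl fun L hL => ?_)) ?_
  · simp only [Finset.mem_sdiff, Finset.mem_Icc] at hL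
    exact congrArg (A L) (min_eq_left (hup L (by omega))).symm
  · have e1 : ∑ L ∈ Finset.Icc 1 M, A L (c L) = ∑ L ∈ Finset.Icc (u + 1) M, A L (u + 1) := by
      symm
      apply Finset.sum_subset_zero_on_sdiff (Finset.Icc_subset_Icc_left (by omega))
      · intro L hL
        simp only [Finset.mem_sdiff, Finset.mem_Icc] at hL
        rw [hmin L (by omega)]
        exact hA.big _ _ (by omega)
      · intro L hL
        rw [hmin L (Finset.mem_Icc.1 hL).2]
    have e2 : ∑ L ∈ Finset.Icc 1 M, A L (min (c L) u) = ∑ L ∈ Finset.Icc u M, A L u := by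
      symm
      have h5 : ∀ L ≤ M, min (c L) u = u := fun L hL => by rw [hmin L hL]; omega
      apply Finset.sum_subset_zero_on_sdiff (Finset.Icc_subset_Icc_left (by omega))
      · intro L hL
        simp only [Finset.mem_sdiff, Finset.mem_Icc] at hL
        rw [h5 L (by omega)]
        exact hA.big _ _ (by omega)
      · intro L hL
        rw [h5 L (Finset.mem_Icc.1 hL).2]
    rw [e1, e2]
    exact key

end SinkDown

/-! ### Moving a source up. -/

theorem sum_ne_bot {ι : Type*} {s : Finset ι} {f : ι → TropNum} (h : ∑ x ∈ s, f x ≠ ⊥) {x : ι}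
    (hx : x ∈ s) : f x ≠ ⊥ := by
  classical
  intro h1
  apply h
  rw [← Finset.add_sum_erase s f hx, h1, WithBot.bot_add]

/-- One can move up the source `s` of a family of non-intersecting paths to the next line, if this
line is free, without decreasing the weight. -/
theorem exists_sourceUp {ι : Type*} {n s : ℕ} {A : ℕ → ℕ → TropNum} (hA : GoodWeights n A)
    (J : Finset ι) (a b : ι → ℕ) (c : ι → ℕ → ℕ)
    (hr : ∀ x ∈ J, IsRoute n (a x) (b x) (c x))
    (hs : ∀ x ∈ J, ∀ y ∈ J, x ≠ y → RoutesDisjoint (c x) (c y))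
    {p : ι} (hp : p ∈ J) (hps : a p = s) (hfree : ∀ x ∈ J, a x ≠ s + 1) (hsn : s + 1 ≤ n) :
    ∃ c' : ι → ℕ → ℕ, IsRoute n (s + 1) (b p) (c' p) ∧
      (∀ x ∈ J, x ≠ p → IsRoute n (a x) (b x) (c' x)) ∧
      (∀ x ∈ J, ∀ y ∈ J, x ≠ y → RoutesDisjoint (c' x) (c' y)) ∧
      ∑ x ∈ J, routeWeight A n (c x) ≤ ∑ x ∈ J, routeWeight A n (c' x) := by
  classical
  have hs1 : 1 ≤ s := hps ▸ (hr p hp).one_le.trans (hr p hp).le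
  -- The path `p` is to leave line `s + 1` at column 1. A path leaving line `s + 2` at column 1 must
  -- then be pushed to column 2, one leaving line `s + 3` at column 2 must be pushed to column 3,
  -- and so on. `X r` is the path pushed on line `s + r` from column `r - 1` to column `r`; the
  -- chain stops at the first unused cell `(s + q + 1, q)`.
  obtain ⟨q, X, hq, hX1, hX, hunused⟩ : ∃ (q : ℕ) (X : ℕ → ι), 1 ≤ q ∧ X 1 = p ∧
      (∀ r, 1 ≤ r → r ≤ q → X r ∈ J ∧ c (X r) (s + r) = r - 1) ∧
      ∀ x ∈ J, c x (s + q + 1) ≠ q := by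
    have hex : ∃ q, 1 ≤ q ∧ ∀ x ∈ J, c x (s + q + 1) ≠ q := by
      refine ⟨n + 1, by omega, fun x hx => ?_⟩
      rw [(hr x hx).high _ (by have := (hr x hx).le_n; omega)]
      omega
    have hX : ∀ r, ∃ x, (r = 1 → x = p) ∧ (1 ≤ r → r ≤ Nat.find hex →
        x ∈ J ∧ c x (s + r) = r - 1) := by
      intro r
      rcases Nat.lt_or_ge r 2 with h2 | h2
      · refine ⟨p, fun _ => rfl, fun h1 _ => ⟨hp, ?_⟩⟩
        rw [(hr p hp).high _ (by omega)]
        omega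
      · by_cases h3 : r ≤ Nat.find hex
        · have h4 := Nat.find_min hex (m := r - 1) (by omega)
          push Not at h4
          obtain ⟨x, hx, hxr⟩ := h4 (by omega)
          refine ⟨x, by omega, fun _ _ => ⟨hx, ?_⟩⟩
          rwa [show s + (r - 1) + 1 = s + r by omega] at hxr
        · exact ⟨p, by omega, by omega⟩
    choose X hX1 hX using hX
    exact ⟨Nat.find hex, X, (Nat.find_spec hex).1, hX1 1 rfl, hX, (Nat.find_spec hex).2⟩
  -- There is room for the push: the new column `r` does not exceed the column on the line below.
  -- The induction uses that, on line `s + r - 1`, the path `X (r + 1)` lies to the right of `X r`.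
  have hkey : ∀ r, 1 ≤ r → r ≤ q → r ≤ c (X r) (s + r - 1) := by
    intro r h1
    induction r, h1 using Nat.le_induction with
    | base =>
      intro _
      rw [hX1]
      exact (hr p hp).pos _ (by omega)
    | succ r h1 ih =>
      intro h2
      have ih := ih (by omega)
      obtain ⟨hy, hyc⟩ := hX r h1 (by omega)
      obtain ⟨hx, hxc⟩ := hX (r + 1) (by omega) h2
      set y := X r
      set x := X (r + 1)
      have ry := hr y hy
      have rx := hr x hx
      rw [show s + (r + 1) - 1 = s + r by omega]
      have hxy : x ≠ y := by
        intro h3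
        rw [h3] at hxc
        have := ry.anti (show s + r ≤ s + (r + 1) by omega)
        omega
      have hax : s + (r + 1) ≤ a x := by
        by_contra h3
        have := rx.high (s + (r + 1)) (by omega)
        omega
      by_cases hbx : s + r ≤ b x
      · have := rx.low _ hbx
        omega
      have vx := (rx.visits_iff (s + r - 1)).2 (by omega)
      have hby : b y ≤ s + r - 1 := by
        by_contra h3
        have := ry.low (s + r) (by omega)
        omega
      have hay : s + r - 1 ≤ a y := by
        by_contra h3
        have := ry.high (s + r - 1) (by omega)
        omega
      have vy := (ry.visits_iff (s + r - 1)).2 ⟨hby, hay⟩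
      have h3 := hs x hx y hy hxy _ vx.1 vx.2 vy.1 vy.2
      rw [show s + r - 1 + 1 = s + r by omega] at h3
      have h4 := rx.anti (show s + r - 1 ≤ s + (r + 1) by omega)
      omega
  -- Disjoint paths leave a common line at distinct columns, so each cell of the chain has only one
  -- path to push.
  have huniq : ∀ r, 1 ≤ r → r + 1 ≤ q → ∀ y ∈ J, c y (s + r + 1) = r → y = X (r + 1) := by
    intro r h1 h2 y hy hyc
    obtain ⟨hx, hxc⟩ := hX (r + 1) (by omega) h2
    by_contra hne
    rw [← add_assoc] at hxc
    have h3 := hs y hy _ hx hne (s + r + 1) (by omega) (by omega) (by omega) (by omega)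
    have h4 := (hr y hy).anti (Nat.le_succ (s + r + 1))
    have h5 := (hr _ hx).anti (Nat.le_succ (s + r + 1))
    simp only [Nat.succ_eq_add_one] at h4 h5
    omega
  have hqn : s + q ≤ n := by
    rcases Nat.lt_or_ge q 2 with h2 | h2
    · omega
    · obtain ⟨hx, hxc⟩ := hX q hq le_rfl
      by_contra h3
      have := (hr _ hx).high (s + q) (by have := (hr _ hx).le_n; omega)
      omega
  let c' : ι → ℕ → ℕ := fun x L => if s + 1 ≤ L ∧ L ≤ s + q ∧ X (L - s) = x then L - s else c x L
  have hc'X : ∀ r, 1 ≤ r → r ≤ q → c' (X r) (s + r) = r := by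
    intro r h1 h2
    have h3 : s + r - s = r := by omega
    simp only [c', h3]
    rw [if_pos ⟨by omega, by omega, trivial⟩]
  have hc'or : ∀ x L, c' x L = c x L ∨ ∃ r, 1 ≤ r ∧ r ≤ q ∧ L = s + r ∧ x = X r := by
    intro x L
    by_cases h1 : s + 1 ≤ L ∧ L ≤ s + q ∧ X (L - s) = x
    · exact Or.inr ⟨L - s, by omega, by omega, by omega, h1.2.2.symm⟩
    · exact Or.inl (if_neg h1)
  have hle : ∀ x L, c x L ≤ c' x L := by
    intro x L
    rcases hc'or x L with h1 | ⟨r, h1, h2, rfl, rfl⟩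
    · exact h1.ge
    · rw [hc'X r h1 h2, (hX r h1 h2).2]
      omega
  have hroute : ∀ x ∈ J, ∀ a', (x = p → a' = s + 1) → (x ≠ p → a' = a x) →
      IsRoute n a' (b x) (c' x) := by
    intro x hx a' h1 h2
    have rx := hr x hx
    have haa : a x ≤ a' := by
      by_cases h3 : x = p
      · rw [h1 h3, h3, hps]
        omega
      · rw [h2 h3]
    refine ⟨antitone_nat_of_succ_le fun L => ?_, fun L hL => ?_, fun L hL => ?_, fun L hL => ?_,
      rx.one_le, rx.le.trans haa, ?_⟩
    · rcases hc'or x (L + 1) with h3 | ⟨r, h3, h4, h5, rfl⟩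
      · rw [h3]
        exact (rx.anti (Nat.le_succ L)).trans (hle x L)
      · rw [h5, hc'X r h3 h4]
        refine le_trans ?_ (hle _ _)
        have := hkey r h3 h4
        rwa [show s + r - 1 = L by omega] at this
    · rcases hc'or x L with h3 | ⟨r, h3, h4, rfl, rfl⟩
      · rw [h3]
        exact rx.low L hL
      · have := rx.low _ hL
        rw [(hX r h3 h4).2] at this
        omega
    · rcases hc'or x L with h3 | ⟨r, h3, h4, rfl, rfl⟩
      · rw [h3]
        exact rx.high L (by omega)
      · have h5 := rx.high (s + r) (by omega)
        rw [(hX r h3 h4).2] at h5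
        have h6 : r = 1 := by omega
        subst h6
        have := h1 hX1
        omega
    · by_cases h3 : x = p
      · rcases Nat.lt_or_ge s L with h4 | h4
        · have h5 := h1 h3
          have h6 : L = s + 1 := by omega
          rw [h6, h3, ← hX1, hc'X 1 le_rfl hq]
        · refine (rx.pos L ?_).trans (hle x L)
          rw [h3, hps]
          exact h4
      · rw [h2 h3] at hL
        exact (rx.pos L hL).trans (hle x L)
    · by_cases h3 : x = p
      · rw [h1 h3]
        exact hsn
      · rw [h2 h3]
        exact rx.le_n
  -- A path in the way of the cell newly taken on line `s + r` is itself the next one pushed; for `r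
  -- = q` nothing is in the way.
  have hpush : ∀ r, 1 ≤ r → r ≤ q → ∀ y ∈ J, r ≤ c y (s + r + 1) → r < c' y (s + r + 1) := by
    intro r h1 h2 y hy h3
    rcases h3.lt_or_eq with h4 | h4
    · exact h4.trans_le (hle _ _)
    · rcases h2.lt_or_eq with h5 | h5
      · rw [huniq r h1 h5 y hy h4.symm, add_assoc, hc'X (r + 1) (by omega) h5]
        omega
      · rw [h5] at h4
        exact absurd h4.symm (hunused y hy)
  have hmono : ∀ x y, y ∈ J → ∀ L, c x L < c y (L + 1) → c' x L < c' y (L + 1) := by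
    intro x y hy L h
    rcases hc'or x L with h3 | ⟨r, h3, h4, rfl, rfl⟩
    · rw [h3]
      exact h.trans_le (hle _ _)
    · rw [hc'X r h3 h4]
      apply hpush r h3 h4 y hy
      rw [(hX r h3 h4).2] at h
      omega
  -- Line `s + 1` is new for `p`. Since it was free as a source, any other path visiting it arrives
  -- from above, and after the push it arrives to the right of column 1.
  have hnew : ∀ y ∈ J, y ≠ p → s + 1 ≤ a y → c' p (s + 1) < c' y (s + 1 + 1) := by
    intro y hy hyp hay
    have h1 := hc'X 1 le_rfl hq
    rw [hX1] at h1
    rw [h1]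
    exact hpush 1 le_rfl hq y hy ((hr y hy).pos _ (by have := hfree y hy; omega))
  have hr' : ∀ x ∈ J, IsRoute n (if x = p then s + 1 else a x) (b x) (c' x) := fun x hx =>
    hroute x hx _ (fun h => if_pos h) (fun h => if_neg h)
  refine ⟨c', hroute p hp _ (fun _ => rfl) (fun h => absurd rfl h),
    fun x hx hxp => hroute x hx _ (fun h => absurd h hxp) (fun _ => rfl), ?_, ?_⟩
  · intro x hx y hy hxy L h1 h2 h3 h4
    have vx := ((hr' x hx).visits_iff L).1 ⟨h1, h2⟩
    have vy := ((hr' y hy).visits_iff L).1 ⟨h3, h4⟩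
    by_cases hxL : L ≤ a x
    · by_cases hyL : L ≤ a y
      · have wx := ((hr x hx).visits_iff L).2 ⟨vx.1, hxL⟩
        have wy := ((hr y hy).visits_iff L).2 ⟨vy.1, hyL⟩
        rcases hs x hx y hy hxy L wx.1 wx.2 wy.1 wy.2 with h5 | h5
        · exact Or.inl (hmono x y hy L h5)
        · exact Or.inr (hmono y x hx L h5)
      · have hyp : y = p := by
          by_contra h5
          rw [if_neg h5] at vy
          omega
        subst hyp
        rw [if_pos rfl] at vy
        obtain rfl : L = s + 1 := by omega
        exact Or.inr (hnew x hx hxy hxL)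
    · have hxp : x = p := by
        by_contra h5
        rw [if_neg h5] at vx
        omega
      subst hxp
      rw [if_pos rfl] at vx
      obtain rfl : L = s + 1 := by omega
      rw [if_neg hxy.symm] at vy
      exact Or.inl (hnew y hy hxy.symm vy.2)
  · by_cases hbot : ∑ x ∈ J, routeWeight A n (c x) = ⊥
    · rw [hbot]
      exact bot_le
    -- The last pushed path ends at a sink `b ≥ q` by `hkey`. Its weight is finite, hence so is the
    -- weight of the sink `b`, and with it that of the sink `q`.
    have hqq : A q q ≠ ⊥ := by
      obtain ⟨hx, hxc⟩ := hX q hq le_rfl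
      have rx := hr _ hx
      have h1 : routeWeight A n (c (X q)) ≠ ⊥ := sum_ne_bot hbot hx
      have h2 : A (b (X q)) (c (X q) (b (X q))) ≠ ⊥ :=
        sum_ne_bot (s := Finset.Icc 1 n) h1
          (Finset.mem_Icc.2 ⟨rx.one_le, rx.le.trans rx.le_n⟩)
      rw [rx.low _ le_rfl] at h2
      exact hA.ne_bot q _ hq ((hkey q hq le_rfl).trans (rx.le_low _)) (rx.le.trans rx.le_n) h2
    have hD := hA.diagonal s q hs1 hq hqn hqq
    unfold routeWeight
    rw [Finset.sum_comm, Finset.sum_comm (s := J)]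
    have hsub : Finset.Icc (s + 1) (s + q) ⊆ Finset.Icc 1 n :=
      Finset.Icc_subset_Icc (by omega) hqn
    rw [← Finset.sum_sdiff hsub, ← Finset.sum_sdiff hsub]
    refine add_le_add (le_of_eq (Finset.sum_congr rfl fun L hL =>
      Finset.sum_congr rfl fun x hx => ?_)) ?_
    · simp only [Finset.mem_sdiff, Finset.mem_Icc] at hL
      rcases hc'or x L with h3 | ⟨r, h3, h4, rfl, rfl⟩
      · rw [h3]
      · omega
    -- On each line `L` of the chain only `X (L - s)` changes its column. Splitting it off leaves
    -- equal remainders and the two sides of the diagonal inequality.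
    · have e1 : ∑ L ∈ Finset.Icc (s + 1) (s + q), ∑ x ∈ J, A L (c x L) =
          ∑ L ∈ Finset.Icc (s + 1) (s + q),
            (A L (L - s - 1) + ∑ x ∈ J.erase (X (L - s)), A L (c x L)) := by
        refine Finset.sum_congr rfl fun L hL => ?_
        rw [Finset.mem_Icc] at hL
        have h1 := hX (L - s) (by omega) (by omega)
        rw [show s + (L - s) = L by omega] at h1
        rw [← Finset.add_sum_erase J _ h1.1, h1.2]
      have e2 : ∑ L ∈ Finset.Icc (s + 1) (s + q), ∑ x ∈ J, A L (c' x L) =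
          ∑ L ∈ Finset.Icc (s + 1) (s + q),
            (A L (L - s) + ∑ x ∈ J.erase (X (L - s)), A L (c x L)) := by
        refine Finset.sum_congr rfl fun L hL => ?_
        rw [Finset.mem_Icc] at hL
        have h1 := hX (L - s) (by omega) (by omega)
        have h2 := hc'X (L - s) (by omega) (by omega)
        rw [show s + (L - s) = L by omega] at h2
        rw [← Finset.add_sum_erase J _ h1.1, h2]
        congr 1
        refine Finset.sum_congr rfl fun x hx => ?_
        rcases hc'or x L with h3 | ⟨r, h3, h4, h5, rfl⟩
        · rw [h3]
        · rw [show L - s = r by omega] at hx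
          simp at hx
      rw [e1, e2, Finset.sum_add_distrib, Finset.sum_add_distrib]
      exact add_le_add_left hD _

/-! ### From the Gelfand–Zeitlin inequalities to column and diagonal inequalities. -/

/-- The weights of the essential edges as a function of two natural numbers: the weight of the
slanted edge `(L, i)` if `i < L`, and the weight of the edge adjacent to the sink `L` if `i = L`. -/
def stdEntry {n : ℕ} (w : StdE n → TropNum) (L i : ℕ) : TropNum :=
  if h : 1 ≤ i ∧ i < L ∧ L ≤ n then w (.slant L i h.1 h.2.1 h.2.2)
  else if h : 1 ≤ L ∧ L ≤ n ∧ i = L then w (sinkEdge n L h.1 h.2.1)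
  else 0

theorem stdEntry_slant {n : ℕ} (w : StdE n → TropNum) (L i : ℕ) (h1 : 1 ≤ i) (h2 : i < L)
    (h3 : L ≤ n) : stdEntry w L i = w (.slant L i h1 h2 h3) :=
  dif_pos ⟨h1, h2, h3⟩

theorem stdEntry_self {n : ℕ} (w : StdE n → TropNum) (L : ℕ) (h1 : 1 ≤ L) (h2 : L ≤ n) :
    stdEntry w L L = w (sinkEdge n L h1 h2) := by
  rw [stdEntry, dif_neg (by omega), dif_pos ⟨h1, h2, rfl⟩]

theorem weight_horiz {n : ℕ} {w : StdE n → TropNum} (hw : w ∈ stdWeightings n) (v : StdV n)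
    (h : v.x < 2 * v.l) :
    w (.horiz v h) = if nextX n v.l v.x = 2 * v.l then stdEntry w v.l v.l else 0 := by
  split_ifs with h1
  · rw [stdEntry_self w v.l v.one_le v.le_n]
    congr 1
    unfold sinkEdge
    congr 1
    ext
    · rfl
    · unfold nextX at h1
      dsimp only
      split_ifs at h1 ⊢ <;> omega
  · apply hw
    rintro (⟨l, i, hi, hil, hl, h2⟩ | ⟨l, h2, hl, h3⟩)
    · cases h2
    · unfold sinkEdge at h3
      cases h3
      apply h1
      unfold nextX
      dsimp only
      split_ifs <;> omega

theorem lineEdges_weight {n : ℕ} {w : StdE n → TropNum} (hw : w ∈ stdWeightings n) (l y : ℕ)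
    (h1 : 1 ≤ l) (hl : l ≤ n) (hy : y ≤ 2 * l) (hye : Even y) (x : ℕ) (hx : l = n → Even x) :
    ((lineEdges n l y h1 hl hy x hx).map w).sum =
      if x < y ∧ y = 2 * l then stdEntry w l l else 0 := by
  rw [lineEdges]
  split_ifs with h h2 h2
  · rw [List.map_cons, List.sum_cons, weight_horiz hw]
    have hlt : y - nextX n l x < y - x := by
      unfold nextX at h ⊢; split_ifs at h ⊢ <;> omega
    rw [lineEdges_weight hw l y h1 hl hy hye (nextX n l x)]
    dsimp only
    rcases h.lt_or_eq with h3 | h3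
    · rw [if_neg (by omega), if_pos ⟨h3, h2.2⟩, zero_add]
    · rw [if_pos (by omega), if_neg (by omega), add_zero]
  · rw [List.map_cons, List.sum_cons, weight_horiz hw]
    have hlt : y - nextX n l x < y - x := by
      unfold nextX at h ⊢; split_ifs at h ⊢ <;> omega
    rw [lineEdges_weight hw l y h1 hl hy hye (nextX n l x)]
    dsimp only
    have h3 : x < y := by
      unfold nextX at h; split_ifs at h <;> omega
    rw [if_neg (by omega), if_neg (by omega), zero_add]
  · exfalso
    unfold nextX at h
    split_ifs at h with hn
    · obtain ⟨a, ha⟩ := hx hn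
      omega
    · omega
  · rfl
termination_by y - x

theorem stairEdges_weight {n : ℕ} {w : StdE n → TropNum} (hw : w ∈ stdWeightings n) (j : ℕ)
    (hj : 1 ≤ j) (d : ℕ) (h : j + d ≤ n) :
    ((stairEdges n j hj d h).map w).sum =
      if d = 0 then 0 else ∑ m ∈ Finset.range (d + 1), stdEntry w (j + m) j := by
  induction d with
  | zero => rfl
  | succ d ih =>
    rw [stairEdges, List.map_cons, List.map_cons, List.sum_cons, List.sum_cons, ih (by omega),
      if_neg (Nat.succ_ne_zero d), Finset.sum_range_succ _ (d + 1), weight_horiz hw,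
      ← stdEntry_slant w (j + d + 1) j hj (by omega) h]
    have h1 : nextX n (j + d) (2 * j - 1) = 2 * j := by
      unfold nextX
      rw [if_neg (by omega)]
      omega
    dsimp only
    rw [h1, add_comm]
    congr 1
    rcases d with _ | d
    · simp
    · rw [if_neg (by omega), if_neg (by omega), zero_add]

theorem stairPath_weight {n : ℕ} {w : StdE n → TropNum} (hw : w ∈ stdWeightings n) (j d : ℕ)
    (hj : 1 ≤ j) (h : j + d ≤ n) :
    (stairPath n j d hj h).weight w = ∑ m ∈ Finset.range (d + 1), stdEntry w (j + m) j := by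
  unfold Network.Path.weight stairPath
  dsimp only
  rw [List.map_append, List.sum_append, stairEdges_weight hw,
    lineEdges_weight hw _ _ _ _ _ (even_two_mul j)]
  rcases d with _ | d
  · rw [if_pos (by omega)]
    simp
  · rw [if_neg (by omega), if_neg (by omega), zero_add]

/-- The staircase to the sink `j` collects the entries of column `j` on the lines `j, …, j + l - i`,
so `m_i^{(l)}` is the sum over a parallelogram of entries. In the Gelfand–Zeitlin inequalities these
parallelograms cancel except for a column or a diagonal. -/
theorem stdA_eq {n : ℕ} {w : StdE n → TropNum} (hw : w ∈ stdWeightings n) (i l : ℕ) (hil : i ≤ l)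
    (hl : l ≤ n) :
    stdA w i l =
      ∑ r ∈ Finset.range i, ∑ m ∈ Finset.range (l - i + 1), stdEntry w (r + 1 + m) (r + 1) := by
  rw [stdA, dif_pos ⟨hil, hl⟩, Network.Multipath.weight, Finset.sum_range]
  refine Finset.sum_congr rfl fun r _ => ?_
  exact stairPath_weight hw _ _ _ _

theorem sum_eq_bot_iff_exists {ι : Type*} (s : Finset ι) (f : ι → TropNum) :
    ∑ x ∈ s, f x = ⊥ ↔ ∃ x ∈ s, f x = ⊥ := by
  classical
  induction s using Finset.induction_on with
  | empty => simp
  | insert x s hx ih =>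
    rw [Finset.sum_insert hx, WithBot.add_eq_bot, ih]
    simp

theorem sum_ne_bot_of_forall {ι : Type*} {s : Finset ι} {f : ι → TropNum}
    (h : ∀ x ∈ s, f x ≠ ⊥) : ∑ x ∈ s, f x ≠ ⊥ := by
  rw [Ne, sum_eq_bot_iff_exists]
  push Not
  exact h

section GelfandZeitlin

variable {n : ℕ} {w : StdE n → TropNum}

theorem sinkWeight_ne_bot
    (hsink : ∀ l, 1 ≤ l → l + 1 ≤ n → stdEntry w l l = ⊥ → stdEntry w (l + 1) (l + 1) = ⊥)
    (q b : ℕ) (hq : 1 ≤ q) (hqb : q ≤ b) (hb : b ≤ n) (h : stdEntry w b b ≠ ⊥) :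
    stdEntry w q q ≠ ⊥ := by
  induction b, hqb using Nat.le_induction with
  | base => exact h
  | succ b hqb ih =>
    exact ih (by omega) fun h1 => h (hsink b (by omega) hb h1)

/-- This makes cancellation possible. The number `m_i^{(i)}` is a sum of sink weights, finite by the
sink condition. With the earlier columns finite, the first Gelfand–Zeitlin inequality bounds
`m_i^{(l+1)}` below by finite terms, so all the `m_i^{(l)}` are finite, and the entry is a summand
of one of them. -/
theorem stdEntry_ne_bot (hw : w ∈ stdWeightings n) (hGZ : IsGelfandZeitlin w)
    (hsink : ∀ l, 1 ≤ l → l + 1 ≤ n → stdEntry w l l = ⊥ → stdEntry w (l + 1) (l + 1) = ⊥)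
    (i d : ℕ) (hi : 1 ≤ i) (hd : i + d ≤ n) (h : stdEntry w i i ≠ ⊥) :
    stdEntry w (i + d) i ≠ ⊥ := by
  have hd' : d ≤ n - i := by omega
  have hin : i ≤ n := by omega
  clear hd
  induction i using Nat.strong_induction_on generalizing d with
  | _ i ih =>
    have hlow : ∀ j, 1 ≤ j → j < i → ∀ e, j + e ≤ n → stdEntry w (j + e) j ≠ ⊥ :=
      fun j h1 h2 e he =>
      ih j h2 e h1 (sinkWeight_ne_bot hsink j i h1 h2.le hin h) (by omega) (by omega)
    have hm : ∀ e, i + e ≤ n → stdA w i (i + e) ≠ ⊥ := by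
      intro e
      induction e with
      | zero =>
        intro h1
        rw [stdA_eq hw _ _ (by omega) h1]
        refine sum_ne_bot_of_forall fun r hr => sum_ne_bot_of_forall fun m hm => ?_
        rw [Finset.mem_range] at hr hm
        rw [show m = 0 by omega]
        exact sinkWeight_ne_bot hsink _ i (by omega) (by omega) hin h
      | succ e ihe =>
        intro h1 h2
        have h3 := (hGZ.2 i (i + e) hi (by omega) h1).1
        rw [← add_assoc] at h2
        rw [h2, WithBot.bot_add, le_bot_iff, WithBot.add_eq_bot] at h3
        rcases h3 with h3 | h3
        · rw [stdA_eq hw _ _ (by omega) (by omega)] at h3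
          refine sum_ne_bot_of_forall (fun r hr => sum_ne_bot_of_forall fun m hm => ?_) h3
          rw [Finset.mem_range] at hr hm
          exact hlow _ (by omega) (by omega) _ (by omega)
        · exact ihe (by omega) h3
    have h1 := hm d (by omega)
    rw [stdA_eq hw _ _ (by omega) (by omega)] at h1
    have h2 := sum_ne_bot h1 (x := i - 1) (Finset.mem_range.2 (by omega))
    have h3 := sum_ne_bot h2 (x := d) (Finset.mem_range.2 (by omega))
    rwa [show i - 1 + 1 = i by omega] at h3

theorem sum_Icc_eq_sum_range (f : ℕ → TropNum) (a b : ℕ) :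
    ∑ L ∈ Finset.Icc a b, f L = ∑ m ∈ Finset.range (b + 1 - a), f (a + m) := by
  rw [← Finset.sum_Ico_eq_sum_range]
  rfl

theorem goodWeights_stdEntry (hw : w ∈ stdWeightings n) (hGZ : IsGelfandZeitlin w)
    (hsink : ∀ l, 1 ≤ l → l + 1 ≤ n → stdEntry w l l = ⊥ → stdEntry w (l + 1) (l + 1) = ⊥) :
    GoodWeights n (stdEntry w) where
  zero L := by rw [stdEntry, dif_neg (by omega), dif_neg (by omega)]
  big L i h := by rw [stdEntry, dif_neg (by omega), dif_neg (by omega)]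
  ne_bot q b hq hqb hb h := sinkWeight_ne_bot hsink q b hq hqb hb h
  column u M hu huM hM := by
    -- In the infinite case the left side is `⊥`. Otherwise the columns `1, …, u + 1` are finite,
    -- and the common parallelograms `X` and `Y` cancel.
    by_cases h : stdEntry w (u + 1) (u + 1) = ⊥
    · rw [(sum_eq_bot_iff_exists _ (fun L => stdEntry w L (u + 1))).2
        ⟨u + 1, Finset.mem_Icc.2 ⟨le_rfl, huM⟩, h⟩]
      exact bot_le
    have hfin : ∀ j, 1 ≤ j → j ≤ u + 1 → ∀ e, j + e ≤ n → stdEntry w (j + e) j ≠ ⊥ :=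
      fun j h1 h2 e he => stdEntry_ne_bot hw hGZ hsink j e h1 he
        (sinkWeight_ne_bot hsink j (u + 1) h1 h2 (by omega) h)
    have h1 := (hGZ.2 u (M - 1) hu (by omega) (by omega)).2
    rw [show M - 1 + 1 = M by omega] at h1
    rw [stdA_eq hw _ _ (by omega) (by omega), stdA_eq hw _ _ (by omega) (by omega),
      stdA_eq hw _ _ (by omega) (by omega), stdA_eq hw _ _ (by omega) (by omega)] at h1
    rw [sum_Icc_eq_sum_range, sum_Icc_eq_sum_range]
    obtain ⟨v, rfl⟩ : ∃ v, u = v + 1 := ⟨u - 1, by omega⟩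
    obtain ⟨N, rfl⟩ : ∃ N, M = v + 2 + N := ⟨M - (v + 2), by omega⟩
    rw [show v + 2 + N - (v + 1 + 1) + 1 = N + 1 by omega,
      show v + 2 + N - 1 - (v + 1 - 1) + 1 = N + 2 by omega,
      show v + 2 + N - (v + 1) + 1 = N + 2 by omega,
      show v + 2 + N - 1 - (v + 1) + 1 = N + 1 by omega,
      show v + 1 - 1 = v by omega,
      Finset.sum_range_succ (n := v + 1), Finset.sum_range_succ (n := v) (f := fun r =>
        ∑ m ∈ Finset.range (N + 2), stdEntry w (r + 1 + m) (r + 1))] at h1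
    rw [show v + 2 + N + 1 - (v + 1 + 1) = N + 1 by omega,
      show v + 2 + N + 1 - (v + 1) = N + 2 by omega]
    have hX : ∑ r ∈ Finset.range (v + 1), ∑ m ∈ Finset.range (N + 1),
        stdEntry w (r + 1 + m) (r + 1) ≠ ⊥ :=
      sum_ne_bot_of_forall fun r hr => sum_ne_bot_of_forall fun m hm => by
        rw [Finset.mem_range] at hr hm
        exact hfin _ (by omega) (by omega) _ (by omega)
    have hY : ∑ r ∈ Finset.range v, ∑ m ∈ Finset.range (N + 2),
        stdEntry w (r + 1 + m) (r + 1) ≠ ⊥ :=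
      sum_ne_bot_of_forall fun r hr => sum_ne_bot_of_forall fun m hm => by
        rw [Finset.mem_range] at hr hm
        exact hfin _ (by omega) (by omega) _ (by omega)
    set X := ∑ r ∈ Finset.range (v + 1), ∑ m ∈ Finset.range (N + 1),
        stdEntry w (r + 1 + m) (r + 1)
    set Y := ∑ r ∈ Finset.range v, ∑ m ∈ Finset.range (N + 2),
        stdEntry w (r + 1 + m) (r + 1)
    rw [add_comm X, add_comm Y] at h1
    exact WithBot.le_of_add_le_add_right hX (WithBot.le_of_add_le_add_right hY (by
      rwa [add_right_comm _ Y] at h1))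
  diagonal s q hs hq hsq h := by
    have hfin : ∀ j, 1 ≤ j → j ≤ q → ∀ e, j + e ≤ n → stdEntry w (j + e) j ≠ ⊥ :=
      fun j h1 h2 e he => stdEntry_ne_bot hw hGZ hsink j e h1 he
        (sinkWeight_ne_bot hsink j q h1 h2 (by omega) h)
    have h1 := (hGZ.2 q (s + q - 1) hq (by omega) (by omega)).1
    rw [show s + q - 1 + 1 = s + q by omega] at h1
    rw [stdA_eq hw _ _ (by omega) (by omega), stdA_eq hw _ _ (by omega) (by omega),
      stdA_eq hw _ _ (by omega) (by omega), stdA_eq hw _ _ (by omega) (by omega)] at h1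
    rw [sum_Icc_eq_sum_range, sum_Icc_eq_sum_range]
    obtain ⟨p, rfl⟩ : ∃ p, q = p + 1 := ⟨q - 1, by omega⟩
    rw [show s + (p + 1) - (p + 1 - 1) + 1 = s + 1 + 1 by omega,
      show s + (p + 1) - 1 - (p + 1) + 1 = s by omega,
      show s + (p + 1) - (p + 1) + 1 = s + 1 by omega,
      show s + (p + 1) - 1 - (p + 1 - 1) + 1 = s + 1 by omega,
      show p + 1 - 1 = p by omega] at h1
    simp only [Finset.sum_range_succ _ (s + 1), Finset.sum_range_succ _ s,
      Finset.sum_add_distrib] at h1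
    rw [show s + (p + 1) + 1 - (s + 1) = p + 1 by omega]
    have hX : ∑ r ∈ Finset.range (p + 1), ∑ m ∈ Finset.range s,
        stdEntry w (r + 1 + m) (r + 1) ≠ ⊥ :=
      sum_ne_bot_of_forall fun r hr => sum_ne_bot_of_forall fun m hm => by
        rw [Finset.mem_range] at hr hm
        exact hfin _ (by omega) (by omega) _ (by omega)
    have hY : (∑ r ∈ Finset.range p, ∑ m ∈ Finset.range s,
        stdEntry w (r + 1 + m) (r + 1)) +
          ∑ r ∈ Finset.range p, stdEntry w (r + 1 + s) (r + 1) ≠ ⊥ := by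
      rw [Ne, WithBot.add_eq_bot, not_or]
      refine ⟨sum_ne_bot_of_forall fun r hr => sum_ne_bot_of_forall fun m hm => ?_,
        sum_ne_bot_of_forall fun r hr => ?_⟩
      · rw [Finset.mem_range] at hr hm
        exact hfin _ (by omega) (by omega) _ (by omega)
      · rw [Finset.mem_range] at hr
        exact hfin _ (by omega) (by omega) _ (by omega)
    -- The first term lies in column 0 and vanishes: before its push, the first path of the chain
    -- had no edge on line `s + 1`.
    have e1 : ∑ m ∈ Finset.range (p + 1), stdEntry w (s + 1 + m) (s + 1 + m - s - 1) =
        ∑ r ∈ Finset.range p, stdEntry w (r + 1 + (s + 1)) (r + 1) := by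
      rw [Finset.sum_range_succ', stdEntry, dif_neg (by omega), dif_neg (by omega), add_zero]
      refine Finset.sum_congr rfl fun r _ => ?_
      congr 1 <;> omega
    have e2 : ∑ m ∈ Finset.range (p + 1), stdEntry w (s + 1 + m) (s + 1 + m - s) =
        ∑ r ∈ Finset.range (p + 1), stdEntry w (r + 1 + s) (r + 1) := by
      refine Finset.sum_congr rfl fun r _ => ?_
      congr 1 <;> omega
    rw [e1, e2]
    refine WithBot.le_of_add_le_add_right hX (WithBot.le_of_add_le_add_right hY ?_)
    refine le_trans (le_of_eq ?_) (h1.trans (le_of_eq ?_))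
    · abel
    · abel

end GelfandZeitlin

/-! ### Vertices and weights of the concatenation. -/

open Network

/-- The sequence of `K + 1` copies of the standard network. -/
abbrev stdSeq (n K : ℕ) : Fin (K + 1) → Network n := fun _ => stdNetwork n

/-- The vertex `v` of the `t`-th standard network, as a vertex of the concatenation. -/
abbrev concatMk {n K : ℕ} (t : Fin (K + 1)) (v : StdV n) : ConcatV (stdSeq n K) :=
  Quot.mk _ ⟨t, v⟩

/-- Coordinates on the vertices of the concatenation; the vertices that lie in two networks get the
coordinates of the source of the second one. -/
def concatCoords (n K : ℕ) : ConcatV (stdSeq n K) → ℕ × ℕ × ℕ :=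
  Quot.lift (fun v => if v.2.x = 2 * v.2.l ∧ (v.1 : ℕ) < K then ((v.1 : ℕ) + 1, v.2.l, 0)
    else ((v.1 : ℕ), v.2.l, v.2.x)) (by
      rintro _ _ ⟨t, a⟩
      simp)

theorem concatCoords_mk {n K : ℕ} (t : Fin (K + 1)) (v : StdV n) :
    concatCoords n K (concatMk t v) = if v.x = 2 * v.l ∧ (t : ℕ) < K then ((t : ℕ) + 1, v.l, 0)
      else ((t : ℕ), v.l, v.x) := rfl

theorem concatMk_sink {n K : ℕ} (t : Fin (K + 1)) (ht : (t : ℕ) < K) (v z : StdV n)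
    (hv : v.x = 2 * v.l) (hz : z.x = 0) (hl : v.l = z.l) :
    concatMk t v = concatMk (⟨t + 1, by omega⟩ : Fin (K + 1)) z := by
  have h := Quot.sound (Glue.glue (N := stdSeq n K) ⟨t, ht⟩ ⟨v.l - 1, by
    have := v.one_le
    have := v.le_n
    omega⟩)
  have h1 := v.one_le
  have e1 : v = (stdNetwork n).sink ⟨v.l - 1, by have := v.le_n; omega⟩ := by
    ext
    · change v.l = v.l - 1 + 1
      omega
    · change v.x = 2 * (v.l - 1 + 1)
      omega
  have e2 : z = (stdNetwork n).source ⟨v.l - 1, by have := v.le_n; omega⟩ := by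
    ext
    · change z.l = v.l - 1 + 1
      omega
    · exact hz
  exact (congrArg (concatMk t) e1).trans (h.trans (congrArg (concatMk _) e2.symm))

theorem concatMk_eq_of_lt {n K : ℕ} {t t' : Fin (K + 1)} {v z : StdV n} (hv : v.x < 2 * v.l)
    (hz : z.x < 2 * z.l) (h : concatMk t v = concatMk t' z) : t = t' ∧ v = z := by
  have h1 := congrArg (concatCoords n K) h
  rw [concatCoords_mk, concatCoords_mk, if_neg (by omega), if_neg (by omega)] at h1
  simp only [Prod.mk.injEq] at h1
  exact ⟨Fin.ext h1.1, StdV.ext h1.2.1 h1.2.2⟩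

/-- Gluing can identify a sink only with a source of the following network. Hence a walk that has
reached a sink of the last network it may use cannot continue. -/
theorem concatMk_ne_of_sink {n K : ℕ} {t t' : Fin (K + 1)} {v z : StdV n} (hv : v.x < 2 * v.l)
    (hz : z.x = 2 * z.l) (ht : t ≤ t') : concatMk t v ≠ concatMk t' z := by
  intro h
  have h1 := congrArg (concatCoords n K) h
  rw [Fin.le_def] at ht
  rw [concatCoords_mk, concatCoords_mk, if_neg (by omega)] at h1
  split_ifs at h1 with h2
  · simp only [Prod.mk.injEq] at h1
    omega
  · simp only [Prod.mk.injEq] at h1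
    omega

theorem StdE.src_lt {n : ℕ} (e : StdE n) : e.src.x < 2 * e.src.l := by
  cases e with
  | horiz v h => exact h
  | slant l i hi hil hl =>
    simp only [StdE.src]
    omega

/-- The weights of the essential edges of the concatenation. -/
def concatEntry {n K : ℕ} (w : Fin (K + 1) → StdE n → TropNum) (t : ℕ) : ℕ → ℕ → TropNum :=
  if h : t < K + 1 then stdEntry (w ⟨t, h⟩) else 0

theorem concatEntry_val {n K : ℕ} (w : Fin (K + 1) → StdE n → TropNum) (t : Fin (K + 1)) :
    concatEntry w t = stdEntry (w t) :=
  dif_pos t.2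

theorem concatEntry_zero {n K : ℕ} (w : Fin (K + 1) → StdE n → TropNum) (t L : ℕ) :
    concatEntry w t L 0 = 0 := by
  unfold concatEntry
  split_ifs
  · rw [stdEntry, dif_neg (by omega), dif_neg (by omega)]
  · rfl

theorem routeWeight_eq_add {n : ℕ} {A : ℕ → ℕ → TropNum} {c c' : ℕ → ℕ} {L : ℕ} (h1 : 1 ≤ L)
    (hL : L ≤ n) (h : ∀ M, M ≠ L → A M (c' M) = A M (c M)) (h0 : A L (c L) = 0) :
    routeWeight A n c' = A L (c' L) + routeWeight A n c := by
  unfold routeWeight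
  have hm : L ∈ Finset.Icc 1 n := Finset.mem_Icc.2 ⟨h1, hL⟩
  rw [← Finset.add_sum_erase _ _ hm, ← Finset.add_sum_erase (a := L) _ (fun M => A M (c M)) hm, h0,
    zero_add]
  congr 1
  exact Finset.sum_congr rfl fun M hM => h M (Finset.ne_of_mem_erase hM)

/-- The weight of the path of the concatenation of `K + 1` networks that runs through the `t`-th
network as encoded by `c t`. -/
def totalRouteWeight (A : ℕ → ℕ → ℕ → TropNum) (n K : ℕ) (c : ℕ → ℕ → ℕ) : TropNum :=
  ∑ t ∈ Finset.range (K + 1), routeWeight (A t) n (c t)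

theorem totalRouteWeight_eq_add {n K : ℕ} {A : ℕ → ℕ → ℕ → TropNum} {c c' : ℕ → ℕ → ℕ} {t : ℕ}
    {x : TropNum} (ht : t < K + 1) (h : ∀ s, s ≠ t → c' s = c s)
    (hx : routeWeight (A t) n (c' t) = x + routeWeight (A t) n (c t)) :
    totalRouteWeight A n K c' = x + totalRouteWeight A n K c := by
  unfold totalRouteWeight
  have hm : t ∈ Finset.range (K + 1) := Finset.mem_range.2 ht
  rw [← Finset.add_sum_erase _ _ hm,
    ← Finset.add_sum_erase (a := t) _ (fun s => routeWeight (A s) n (c s)) hm, hx, add_assoc]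
  congr 2
  refine Finset.sum_congr rfl fun s hs => ?_
  rw [h s (Finset.ne_of_mem_erase hs)]

theorem routeWeight_zero {n K : ℕ} (w : Fin (K + 1) → StdE n → TropNum) (t : ℕ) :
    routeWeight (concatEntry w t) n 0 = 0 :=
  Finset.sum_eq_zero fun L _ => concatEntry_zero w t L

theorem totalRouteWeight_zero {n K : ℕ} (w : Fin (K + 1) → StdE n → TropNum) :
    totalRouteWeight (concatEntry w) n K 0 = 0 :=
  Finset.sum_eq_zero fun t _ => routeWeight_zero w t

/-- The columns of the path that runs along line `L`. -/
def constRoute (L : ℕ) : ℕ → ℕ := fun M => if M ≤ L then L else 0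

theorem isRoute_constRoute {n L : ℕ} (h1 : 1 ≤ L) (hL : L ≤ n) :
    IsRoute n L L (constRoute L) where
  anti x y h := by unfold constRoute; split_ifs <;> omega
  low M h := if_pos h
  high M h := if_neg (by omega)
  pos M h := by rw [constRoute, if_pos h]; exact h1
  one_le := h1
  le := le_rfl
  le_n := hL

theorem routeWeight_constRoute {n K : ℕ} (w : Fin (K + 1) → StdE n → TropNum) (t : Fin (K + 1))
    {L : ℕ} (h1 : 1 ≤ L) (hL : L ≤ n) :
    routeWeight (concatEntry w t) n (constRoute L) = stdEntry (w t) L L := by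
  rw [routeWeight_eq_add (c := 0) h1 hL, routeWeight_zero, add_zero, concatEntry_val, constRoute,
    if_pos le_rfl]
  · intro M hM
    rw [Pi.zero_apply, concatEntry_zero, constRoute]
    split_ifs with h
    · rw [concatEntry_val, stdEntry, dif_neg (by omega), dif_neg (by omega)]
    · rw [concatEntry_zero]
  · exact concatEntry_zero w t L

/-! ### From walks to routes. -/

/-- A walk in the concatenation is encoded by the columns of its slanted edges, and runs through all
the vertices between these. -/
theorem exists_routes_of_walk {n K : ℕ} {w : Fin (K + 1) → StdE n → TropNum}
    (hw : ∀ t, w t ∈ stdWeightings n) (i : Fin (K + 1)) (b : Fin n)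
    (es : List (concatUpTo (stdSeq n K) i).E) (t : Fin (K + 1)) (u : StdV n)
    (hu : u.x < 2 * u.l) (hti : t ≤ i)
    (hes : (concatUpTo (stdSeq n K) i).IsWalk (concatMk t u) es
      ((concatUpTo (stdSeq n K) i).sink b)) :
    ∃ (pos : ℕ → ℕ) (c : ℕ → ℕ → ℕ), pos t = u.l ∧ pos (i + 1) = b + 1 ∧
      (∀ s : ℕ, t ≤ s → s ≤ i → IsRoute n (pos s) (pos (s + 1)) (c s)) ∧
      u.x ≤ 2 * c t u.l ∧ (∀ s : ℕ, s < t ∨ i < s → c s = 0) ∧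
      (es.map (concatWeight (stdSeq n K) w i)).sum = totalRouteWeight (concatEntry w) n K c ∧
      ∀ (s : Fin (K + 1)) (z : StdV n), t ≤ s → s ≤ i → pos (s + 1) ≤ z.l → z.l ≤ pos s →
        (s = t → z.l = u.l → u.x ≤ z.x) → 2 * c s (z.l + 1) - 1 ≤ z.x → z.x ≤ 2 * c s z.l →
        concatMk s z = concatMk t u ∨
          ∃ e ∈ es, concatMk s z = (concatUpTo (stdSeq n K) i).tgt e := by
  -- The walk may start in the middle of line `u.l` of the network `t`; its columns there are
  -- recorded as if it had started at the source of that line. Edges are then prepended one at a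
  -- time.
  induction es generalizing t u with
  | nil => exact absurd hes (concatMk_ne_of_sink hu rfl hti)
  | cons e es ih =>
    obtain ⟨h1, h2⟩ := hes
    have hsum : ((e :: es).map (concatWeight (stdSeq n K) w i)).sum =
        w e.1.1 e.1.2 + (es.map (concatWeight (stdSeq n K) w i)).sum := by
      rw [List.map_cons, List.sum_cons]
      rfl
    rw [hsum]
    clear hsum
    obtain ⟨⟨t', e⟩, ht'⟩ := e
    have h3 : concatMk t' e.src = concatMk t u := h1
    obtain ⟨rfl, rfl⟩ := concatMk_eq_of_lt e.src_lt hu h3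
    clear h1 h3
    change (concatUpTo (stdSeq n K) i).IsWalk (concatMk t' e.tgt) es _ at h2
    change ∃ (pos : ℕ → ℕ) (c : ℕ → ℕ → ℕ), _ ∧ _ ∧ _ ∧ _ ∧ _ ∧ w t' e + _ = _ ∧ _
    cases e with
    | horiz v h =>
      have hwe := weight_horiz (hw t') v h
      rw [hwe]
      have hnx : nextX n v.l v.x ≤ 2 * v.l := (StdE.horiz v h).tgt.x_le
      rcases hnx.lt_or_eq with hlt | heq
      · rw [if_neg hlt.ne, zero_add]
        obtain ⟨pos, c, g1, g2, g3, g4, g5, g6, g7⟩ := ih t' _ hlt hti h2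
        refine ⟨pos, c, g1, g2, g3, le_trans ?_ g4, g5, g6, ?_⟩
        · change v.x ≤ nextX n v.l v.x
          unfold nextX
          split_ifs <;> omega
        · intro s z k1 k2 k3 k4 k5 k6 k7
          by_cases k8 : s = t' ∧ z.l = v.l ∧ z.x = v.x
          · left
            rw [k8.1, show z = v from StdV.ext k8.2.1 k8.2.2]
            rfl
          · right
            have k11 : s = t' → z.l = v.l → nextX n v.l v.x ≤ z.x := by
              intro k9 k10
              have k12 : v.x ≤ z.x := k5 k9 k10
              have k13 : z.x ≠ v.x := fun k => k8 ⟨k9, k10, k⟩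
              unfold nextX
              split_ifs with hn
              · obtain ⟨y1, hy1⟩ := v.even_top hn
                obtain ⟨y2, hy2⟩ := z.even_top (k10.trans hn)
                omega
              · omega
            rcases g7 s z k1 k2 k3 k4 k11 k6 k7 with k9 | ⟨e', k9, k10⟩
            · exact ⟨_, List.mem_cons_self, k9⟩
            · exact ⟨e', List.mem_cons_of_mem _ k9, k10⟩
      · rw [if_pos heq]
        have hcell : ∀ c : ℕ → ℕ → ℕ, c t' = 0 →
            totalRouteWeight (concatEntry w) n K (Function.update c t' (constRoute v.l)) =
              stdEntry (w t') v.l v.l + totalRouteWeight (concatEntry w) n K c := by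
          intro c hc
          refine totalRouteWeight_eq_add t'.2 (fun s hs => Function.update_of_ne hs _ _) ?_
          rw [Function.update_self, hc, routeWeight_zero, add_zero,
            routeWeight_constRoute w t' v.one_le v.le_n]
        have hlast : ∀ (z : StdV n), z.l = v.l → v.x ≤ z.x → z.x ≤ 2 * v.l →
            z = v ∨ z = (StdE.horiz v h).tgt := by
          intro z k1 k2 k3
          by_cases k4 : z.x = v.x
          · exact Or.inl (StdV.ext k1 k4)
          · refine Or.inr (StdV.ext k1 ?_)
            change z.x = nextX n v.l v.x
            unfold nextX at heq ⊢
            split_ifs at heq ⊢ with hn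
            · obtain ⟨y1, hy1⟩ := v.even_top hn
              obtain ⟨y2, hy2⟩ := z.even_top (k1.trans hn)
              omega
            · omega
        have hroute := isRoute_constRoute v.one_le v.le_n
        -- Either the sink reached is glued to a source of the next network, where the induction
        -- hypothesis applies, or this is the last network and the walk ends.
        rcases hti.lt_or_eq with hlti | rfl
        · rw [Fin.lt_def] at hlti
          have hi := i.2
          have h5 := concatMk_sink t' (by omega) (StdE.horiz v h).tgt
            (⟨v.l, 0, v.one_le, v.le_n, by omega, fun _ => Even.zero⟩ : StdV n) heq rfl rfl
          rw [h5] at h2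
          have hvl := v.one_le
          obtain ⟨pos, c, g1, g2, g3, g4, g5, g6, g7⟩ := ih ⟨t' + 1, by omega⟩ _
            (show 0 < 2 * v.l by omega) (Fin.le_def.2 hlti) h2
          simp only at g1 g3 g4 g5
          refine ⟨Function.update pos t' v.l, Function.update c t' (constRoute v.l),
            Function.update_self _ _ _, ?_, ?_, ?_, ?_, ?_, ?_⟩
          · rw [Function.update_of_ne (by omega), g2]
          · intro s k1 k2
            rw [Function.update_of_ne (show s + 1 ≠ t' by omega)]
            rcases k1.lt_or_eq with k3 | k3
            · rw [Function.update_of_ne k3.ne', Function.update_of_ne k3.ne']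
              exact g3 s k3 k2
            · subst k3
              rw [Function.update_self, Function.update_self, g1]
              exact hroute
          · rw [Function.update_self]
            change v.x ≤ 2 * constRoute v.l v.l
            rw [constRoute, if_pos le_rfl]
            exact h.le
          · intro s hs
            rw [Function.update_of_ne (by omega)]
            exact g5 s (by omega)
          · rw [hcell c (g5 t' (by omega)), g6]
          · intro s z k1 k2 k3 k4 k5 k6 k7
            rcases k1.lt_or_eq with k8 | rfl
            · right
              rw [Fin.lt_def] at k8
              rw [Function.update_of_ne (by omega)] at k3 k4 k6 k7
              rcases g7 s z (Fin.le_def.2 k8) k2 k3 k4 (fun _ _ => Nat.zero_le _) k6 k7 with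
                k9 | ⟨e', k9, k10⟩
              · rw [← h5] at k9
                exact ⟨_, List.mem_cons_self, k9⟩
              · exact ⟨e', List.mem_cons_of_mem _ k9, k10⟩
            · rw [Function.update_self] at k4 k6 k7
              rw [Function.update_of_ne (by omega), g1] at k3
              have k8 : z.l = v.l := le_antisymm k4 k3
              rw [k8, constRoute, if_pos le_rfl] at k7
              rcases hlast z k8 (k5 rfl k8) k7 with rfl | rfl
              · exact Or.inl rfl
              · exact Or.inr ⟨_, List.mem_cons_self, rfl⟩
        · have hnil : es = [] := by
            cases es with
            | nil => rfl
            | cons e' es =>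
              exfalso
              exact concatMk_ne_of_sink e'.1.2.src_lt heq e'.2 h2.1
          subst hnil
          have hb : v.l = b + 1 := by
            have h5 : concatMk t' (StdE.horiz v h).tgt = concatMk t' ((stdNetwork n).sink b) := h2
            have h6 := congrArg (concatCoords n K) h5
            rw [concatCoords_mk, concatCoords_mk] at h6
            have h7 : (StdE.horiz v h).tgt.x = 2 * (StdE.horiz v h).tgt.l := heq
            have h8 : (StdE.horiz v h).tgt.l = v.l := rfl
            simp only [h7] at h6
            split_ifs at h6 <;> simp_all
          refine ⟨fun _ => v.l, Function.update 0 t' (constRoute v.l), rfl, hb, ?_, ?_, ?_, ?_, ?_⟩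
          · intro s k1 k2
            obtain rfl := le_antisymm k1 k2
            rw [Function.update_self]
            exact hroute
          · rw [Function.update_self]
            change v.x ≤ 2 * constRoute v.l v.l
            rw [constRoute, if_pos le_rfl]
            exact h.le
          · intro s hs
            rw [Function.update_of_ne (by omega)]
            rfl
          · rw [hcell 0 rfl, totalRouteWeight_zero]
            rfl
          · intro s z k1 k2 k3 k4 k5 k6 k7
            obtain rfl := le_antisymm k1 k2
            have k8 : z.l = v.l := le_antisymm k4 k3
            rw [Function.update_self, k8, constRoute, if_pos le_rfl] at k7
            rcases hlast z k8 (k5 rfl k8) k7 with rfl | rfl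
            · exact Or.inl rfl
            · exact Or.inr ⟨_, List.mem_cons_self, rfl⟩
    | slant L j hj hjL hL =>
      obtain ⟨pos, c, g1, g2, g3, g4, g5, g6, g7⟩ := ih t' _
        (show 2 * j - 1 < 2 * (L - 1) by omega) hti h2
      change pos t' = L - 1 at g1
      change 2 * j - 1 ≤ 2 * c t' (L - 1) at g4
      have hr := g3 t' le_rfl hti
      rw [g1] at hr
      have hc0 : c t' L = 0 := hr.high L (by omega)
      -- The remaining walk is encoded as starting on line `L - 1`, so its column on line `L` is 0;
      -- the slanted edge replaces this by `j`.
      set d := Function.update (c t') L j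
      have hdL : d L = j := Function.update_self _ _ _
      have hdne : ∀ M, M ≠ L → d M = c t' M := fun M hM => Function.update_of_ne hM _ _
      have hdr : IsRoute n L (pos (t' + 1)) d := by
        refine ⟨antitone_nat_of_succ_le fun M => ?_, fun M hM => ?_, fun M hM => ?_, fun M hM => ?_,
          hr.one_le, by have := hr.le; omega, hL⟩
        · by_cases k1 : M = L
          · rw [k1, hdne (L + 1) (by omega), hr.high (L + 1) (by omega)]
            exact Nat.zero_le _
          · rw [hdne M k1]
            by_cases k2 : M + 1 = L
            · rw [k2, hdL, show M = L - 1 by omega]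
              omega
            · rw [hdne _ k2]
              exact hr.anti (Nat.le_succ M)
        · have := hr.le
          rw [hdne M (by omega)]
          exact hr.low M hM
        · rw [hdne M (by omega)]
          exact hr.high M (by omega)
        · by_cases k1 : M = L
          · rw [k1, hdL]
            exact hj
          · rw [hdne M k1]
            exact hr.pos M (by omega)
      refine ⟨Function.update pos t' L, Function.update c t' d, Function.update_self _ _ _, ?_, ?_,
        ?_, ?_, ?_, ?_⟩
      · rw [Function.update_of_ne (by have := Fin.le_def.1 hti; omega), g2]
      · intro s k1 k2
        rw [Function.update_of_ne (show s + 1 ≠ t' by omega)]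
        rcases k1.lt_or_eq with k3 | k3
        · rw [Function.update_of_ne k3.ne', Function.update_of_ne k3.ne']
          exact g3 s k1 k2
        · subst k3
          rw [Function.update_self, Function.update_self]
          exact hdr
      · rw [Function.update_self]
        change 2 * j ≤ 2 * d L
        rw [hdL]
      · intro s hs
        rw [Function.update_of_ne (by have := Fin.le_def.1 hti; omega)]
        exact g5 s hs
      · rw [g6]
        symm
        refine totalRouteWeight_eq_add t'.2 (fun s hs => Function.update_of_ne hs _ _) ?_
        rw [Function.update_self, routeWeight_eq_add (c := c t') (L := L) (by omega) hL, hdL,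
          concatEntry_val, stdEntry_slant]
        · intro M hM
          rw [hdne M hM]
        · rw [hc0, concatEntry_zero]
      · intro s z k1 k2 k3 k4 k5 k6 k7
        rw [Function.update_of_ne (by rw [Fin.le_def] at k1; omega)] at k3
        by_cases k8 : s = t' ∧ z.l = L
        · left
          obtain ⟨rfl, k8⟩ := k8
          rw [Function.update_self, k8, hdL] at k7
          have k9 : 2 * j ≤ z.x := k5 rfl k8
          rw [show z = (StdE.slant L j hj hjL hL).src from StdV.ext k8 (le_antisymm k7 k9)]
        · right
          have k9 : ((concatMk s z = concatMk t' (StdE.slant L j hj hjL hL).tgt) ∨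
              ∃ e ∈ es, concatMk s z = (concatUpTo (stdSeq n K) i).tgt e) := by
            by_cases k10 : s = t'
            · subst k10
              rw [Function.update_self] at k4 k6 k7
              have k11 : z.l ≠ L := fun k => k8 ⟨rfl, k⟩
              rw [hdne _ k11] at k7
              apply g7 s z k1 k2 k3 (by omega) _ _ k7
              · intro _ k12
                change z.l = L - 1 at k12
                change 2 * j - 1 ≤ z.x
                rw [k12, show L - 1 + 1 = L by omega, hdL] at k6
                exact k6
              · by_cases k12 : z.l + 1 = L
                · rw [k12, hc0]
                  omega
                · rwa [hdne _ k12] at k6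
            · have k11 : (s : ℕ) ≠ t' := fun k => k10 (Fin.ext k)
              rw [Function.update_of_ne k11] at k4 k6 k7
              exact g7 s z k1 k2 k3 k4 (fun k => absurd k k10) k6 k7
          rcases k9 with k9 | ⟨e', k9, k10⟩
          · exact ⟨_, List.mem_cons_self, k9⟩
          · exact ⟨e', List.mem_cons_of_mem _ k9, k10⟩

/-! ### From routes to walks. -/

theorem lineEdges_le_tgt (n l y : ℕ) (h1 : 1 ≤ l) (hl : l ≤ n) (hy : y ≤ 2 * l) (x : ℕ)
    (hx : l = n → Even x) : ∀ e ∈ lineEdges n l y h1 hl hy x hx, x ≤ e.tgt.x := by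
  intro e he
  rw [lineEdges] at he
  split_ifs at he with h
  · have hle : x < nextX n l x := by unfold nextX; split_ifs <;> omega
    rcases List.mem_cons.1 he with rfl | he
    · exact hle.le
    · exact hle.le.trans (lineEdges_le_tgt n l y h1 hl hy _ _ e he)
  · simp at he
termination_by y - x

/-- A route is encoded by an actual walk in the standard network. -/
theorem IsRoute.exists_walk {n a b : ℕ} {c : ℕ → ℕ} (h : IsRoute n a b c) {w : StdE n → TropNum}
    (hw : w ∈ stdWeightings n) (L : ℕ) (hbL : b ≤ L) (hL : L ≤ a) (u v : StdV n) (hu : u.l = L)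
    (hux : u.x = 2 * c (L + 1) - 1) (hv : v.l = b) (hvx : v.x = 2 * b) :
    ∃ es : List (StdE n), (stdNetwork n).IsWalk u es v ∧
      (es.map w).sum = ∑ M ∈ Finset.Icc 1 L, stdEntry w M (c M) ∧
      ∀ e ∈ es, b ≤ e.tgt.l ∧ e.tgt.l ≤ L ∧ 2 * c (e.tgt.l + 1) - 1 ≤ e.tgt.x ∧
        e.tgt.x ≤ 2 * c e.tgt.l := by
  have hb := h.one_le
  have hn := h.le_n
  have hanti : ∀ M, c (M + 1) ≤ c M := fun M => h.anti (Nat.le_succ M)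
  induction L, hbL using Nat.le_induction generalizing u with
  | base =>
    have hc : c b = b := h.low b le_rfl
    have hc1 := hanti b
    have hx : b = n → Even u.x := fun h1 => u.even_top (hu.trans h1)
    refine ⟨lineEdges n b (2 * b) hb (by omega) le_rfl u.x hx, ?_, ?_, ?_⟩
    · have h1 := lineEdges_isWalk n b (2 * b) hb (by omega) le_rfl (even_two_mul b) u.x hx
        (by omega)
      rwa [show (⟨b, u.x, hb, by omega, by omega, hx⟩ : StdV n) = u from StdV.ext hu.symm rfl,
        show (⟨b, 2 * b, hb, by omega, le_rfl, fun _ => even_two_mul b⟩ : StdV n) = v from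
          StdV.ext hv.symm hvx.symm] at h1
    · rw [lineEdges_weight hw _ _ _ _ _ (even_two_mul b), if_pos ⟨by omega, rfl⟩,
        Finset.sum_eq_single_of_mem b (Finset.mem_Icc.2 ⟨hb, le_rfl⟩), hc]
      intro M hM hMb
      rw [Finset.mem_Icc] at hM
      rw [h.low M hM.2, stdEntry, dif_neg (by omega), dif_neg (by omega)]
    · intro e he
      have h1 := lineEdges_tgt _ _ _ _ _ _ _ _ e he
      have h2 := lineEdges_le_tgt _ _ _ _ _ _ _ _ e he
      rw [h1.1, hc]
      omega
  | succ L hbL ih =>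
    have hc1 := hanti (L + 1)
    have hcb := h.le_low (L + 1)
    have hpos := h.pos (L + 1) hL
    have hx : L + 1 = n → Even u.x := fun h1 => u.even_top (hu.trans h1)
    obtain ⟨es, h1, h2, h3⟩ := ih (by omega)
      (StdE.slant (L + 1) (c (L + 1)) hpos (by omega) (by omega)).tgt rfl rfl
    refine ⟨lineEdges n (L + 1) (2 * c (L + 1)) (by omega) (by omega) (by omega) u.x hx ++
      .slant (L + 1) (c (L + 1)) hpos (by omega) (by omega) :: es, ?_, ?_, ?_⟩
    · have h4 := lineEdges_isWalk n (L + 1) (2 * c (L + 1)) (by omega) (by omega) (by omega)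
        (even_two_mul _) u.x hx (by omega)
      rw [show (⟨L + 1, u.x, by omega, by omega, by omega, hx⟩ : StdV n) = u from
        StdV.ext hu.symm rfl] at h4
      exact isWalk_append _ h4 ⟨rfl, h1⟩
    · rw [List.map_append, List.sum_append, List.map_cons, List.sum_cons, h2,
        lineEdges_weight hw _ _ _ _ _ (even_two_mul _), if_neg (by omega), zero_add,
        Finset.sum_Icc_succ_top (by omega), stdEntry_slant, add_comm]
    · intro e he
      rcases List.mem_append.1 he with he | he
      · have h4 := lineEdges_tgt _ _ _ _ _ _ _ _ e he
        have h5 := lineEdges_le_tgt _ _ _ _ _ _ _ _ e he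
        rw [h4.1]
        omega
      · rcases List.mem_cons.1 he with rfl | he
        · simp only [StdE.tgt, Nat.add_sub_cancel]
          have := hanti L
          omega
        · have := h3 e he
          omega

theorem routeWeight_eq_sum_Icc {n a b : ℕ} {c : ℕ → ℕ} (h : IsRoute n a b c)
    {A : ℕ → ℕ → TropNum} (hA : ∀ L, A L 0 = 0) :
    routeWeight A n c = ∑ L ∈ Finset.Icc 1 a, A L (c L) := by
  symm
  refine Finset.sum_subset (Finset.Icc_subset_Icc_right h.le_n) fun L hL hLa => ?_
  rw [Finset.mem_Icc] at hL hLa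
  rw [h.high L (by omega), hA]

/-- The edge `e` of the `t`-th standard network, as an edge of the concatenation. -/
def concatEdge {n K : ℕ} {i t : Fin (K + 1)} (ht : t ≤ i) (e : StdE n) :
    (concatUpTo (stdSeq n K) i).E :=
  ⟨⟨t, e⟩, ht⟩

theorem isWalk_concat {n K : ℕ} {i t : Fin (K + 1)} (ht : t ≤ i) {u v : StdV n}
    {es : List (StdE n)} (h : (stdNetwork n).IsWalk u es v) :
    (concatUpTo (stdSeq n K) i).IsWalk (concatMk t u) (es.map (concatEdge ht)) (concatMk t v) := by
  induction es generalizing u with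
  | nil => exact congrArg _ h
  | cons e es ih => exact ⟨congrArg (concatMk t) h.1, ih h.2⟩

/-- A vertex of the concatenation lies on the path encoded by `pos` and `c`. -/
def OnRoutes {n K : ℕ} (i : ℕ) (pos : ℕ → ℕ) (c : ℕ → ℕ → ℕ) (v : ConcatV (stdSeq n K)) : Prop :=
  ∃ (s : Fin (K + 1)) (z : StdV n), v = concatMk s z ∧ (s : ℕ) ≤ i ∧ pos (s + 1) ≤ z.l ∧
    z.l ≤ pos s ∧ 2 * c s (z.l + 1) - 1 ≤ z.x ∧ z.x ≤ 2 * c s z.l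

theorem exists_walk_of_route {n K : ℕ} {w : Fin (K + 1) → StdE n → TropNum}
    (hw : ∀ t, w t ∈ stdWeightings n) {i t : Fin (K + 1)} (hti : t ≤ i) (pos : ℕ → ℕ)
    (c : ℕ → ℕ → ℕ) (hr : IsRoute n (pos t) (pos (t + 1)) (c t)) (u v : StdV n)
    (hu : u.l = pos t) (hux : u.x = 0) (hv : v.l = pos (t + 1)) (hvx : v.x = 2 * v.l) :
    ∃ es : List (concatUpTo (stdSeq n K) i).E,
      (concatUpTo (stdSeq n K) i).IsWalk (concatMk t u) es (concatMk t v) ∧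
      (es.map (concatWeight (stdSeq n K) w i)).sum = routeWeight (concatEntry w t) n (c t) ∧
      ∀ e ∈ es, OnRoutes i pos c ((concatUpTo (stdSeq n K) i).tgt e) := by
  obtain ⟨es, h1, h2, h3⟩ := hr.exists_walk (hw t) (pos t) hr.le le_rfl u v hu
    (by rw [hr.high _ (Nat.lt_succ_self _), hux]) hv (by rw [hvx, hv])
  refine ⟨_, isWalk_concat hti h1, ?_, ?_⟩
  · rw [List.map_map, routeWeight_eq_sum_Icc hr (concatEntry_zero w t), concatEntry_val, ← h2]
    rfl
  · intro e he
    obtain ⟨e', he', rfl⟩ := List.mem_map.1 he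
    have h4 := h3 e' he'
    exact ⟨t, e'.tgt, rfl, hti, h4.1, h4.2.1, h4.2.2.1, h4.2.2.2⟩

theorem exists_walk_of_routes {n K : ℕ} {w : Fin (K + 1) → StdE n → TropNum}
    (hw : ∀ t, w t ∈ stdWeightings n) (i : Fin (K + 1)) (pos : ℕ → ℕ) (c : ℕ → ℕ → ℕ)
    (hr : ∀ t : ℕ, t ≤ i → IsRoute n (pos t) (pos (t + 1)) (c t)) (b : Fin n)
    (hb : pos (i + 1) = b + 1) (d : ℕ) (t : Fin (K + 1)) (htd : (t : ℕ) + d = i) (u : StdV n)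
    (hu : u.l = pos t) (hux : u.x = 0) :
    ∃ es : List (concatUpTo (stdSeq n K) i).E,
      (concatUpTo (stdSeq n K) i).IsWalk (concatMk t u) es
        ((concatUpTo (stdSeq n K) i).sink b) ∧
      (es.map (concatWeight (stdSeq n K) w i)).sum =
        ∑ s ∈ Finset.Ico (t : ℕ) (i + 1), routeWeight (concatEntry w s) n (c s) ∧
      ∀ e ∈ es, OnRoutes i pos c ((concatUpTo (stdSeq n K) i).tgt e) := by
  induction d generalizing t u with
  | zero =>
    obtain rfl : t = i := Fin.ext (by omega)
    obtain ⟨es, h1, h2, h3⟩ := exists_walk_of_route hw le_rfl pos c (hr t le_rfl) u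
      ((stdNetwork n).sink b) hu hux hb.symm rfl
    exact ⟨es, h1, by rw [h2]; simp, h3⟩
  | succ d ih =>
    have hi := i.2
    have hrt := hr t (by omega)
    have hpos := hrt.one_le
    have hle : pos (t + 1) ≤ n := hrt.le.trans hrt.le_n
    have hglue := concatMk_sink t (by omega)
      (⟨pos (t + 1), 2 * pos (t + 1), hpos, hle, le_rfl, fun _ => even_two_mul _⟩ : StdV n)
      ⟨pos (t + 1), 0, hpos, hle, by omega, fun _ => Even.zero⟩ rfl rfl rfl
    obtain ⟨es, h1, h2, h3⟩ := exists_walk_of_route hw (i := i) (Fin.le_def.2 (by omega)) pos c hrt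
      u (⟨pos (t + 1), 2 * pos (t + 1), hpos, hle, le_rfl, fun _ => even_two_mul _⟩ : StdV n) hu
      hux rfl rfl
    obtain ⟨fs, g1, g2, g3⟩ := ih ⟨t + 1, by omega⟩ (by change (t : ℕ) + 1 + d = i; omega)
      ⟨pos (t + 1), 0, hpos, hle, by omega, fun _ => Even.zero⟩ rfl rfl
    rw [hglue] at h1
    refine ⟨es ++ fs, isWalk_append _ h1 g1, ?_, ?_⟩
    · rw [List.map_append, List.sum_append, h2, g2,
        Finset.sum_eq_sum_Ico_succ_bot (show (t : ℕ) < i + 1 by omega)]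
    · intro e he
      exact (List.mem_append.1 he).elim (h3 e) (g3 e)

/-! ### Systems of routes and their improvement. -/

theorem RoutesDisjoint.sink_ne {n a b a' b' : ℕ} {c c' : ℕ → ℕ} (hs : RoutesDisjoint c c')
    (h : IsRoute n a b c) (h' : IsRoute n a' b' c') : b ≠ b' := by
  rintro rfl
  have v := (h.visits_iff b).2 ⟨le_rfl, h.le⟩
  have v' := (h'.visits_iff b).2 ⟨le_rfl, h'.le⟩
  have h1 := h.low b le_rfl
  have h1' := h'.low b le_rfl
  have h2 := h.le_low (b + 1)
  have h2' := h'.le_low (b + 1)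
  rcases hs b v.1 v.2 v'.1 v'.2 with h3 | h3 <;> omega

theorem RoutesDisjoint.source_ne {n a b a' b' : ℕ} {c c' : ℕ → ℕ} (hs : RoutesDisjoint c c')
    (h : IsRoute n a b c) (h' : IsRoute n a' b' c') : a ≠ a' := by
  rintro rfl
  have v := (h.visits_iff a).2 ⟨h.le, le_rfl⟩
  have v' := (h'.visits_iff a).2 ⟨h'.le, le_rfl⟩
  have h1 := h.high (a + 1) (Nat.lt_succ_self a)
  have h1' := h'.high (a + 1) (Nat.lt_succ_self a)
  rcases hs a v.1 v.2 v'.1 v'.2 with h3 | h3 <;> omega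

/-- A system of non-intersecting paths in a concatenation of standard networks: the path of index
`x` runs through the networks `0, …, τ x`, through the `t`-th one from the source `pos x t` to the
sink `pos x (t + 1)` as encoded by `c x t`. -/
structure IsRouteSystem {ι : Type*} (n : ℕ) (τ : ι → ℕ) (pos : ι → ℕ → ℕ) (c : ι → ℕ → ℕ → ℕ) :
    Prop where
  route : ∀ x t, t ≤ τ x → IsRoute n (pos x t) (pos x (t + 1)) (c x t)
  disj : ∀ x y t, x ≠ y → t ≤ τ x → t ≤ τ y → RoutesDisjoint (c x t) (c y t)

section RouteSystem

variable {ι : Type*} [Fintype ι]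

/-- The total weight of a system of paths. -/
def systemWeight (A : ℕ → ℕ → ℕ → TropNum) (n K : ℕ) (τ : ι → ℕ) (c : ι → ℕ → ℕ → ℕ) : TropNum :=
  ∑ t ∈ Finset.range (K + 1), ∑ x with t ≤ τ x, routeWeight (A t) n (c x t)

theorem systemWeight_eq_sum {A : ℕ → ℕ → ℕ → TropNum} {n K : ℕ} {τ : ι → ℕ} (hτ : ∀ x, τ x ≤ K)
    (c : ι → ℕ → ℕ → ℕ) :
    systemWeight A n K τ c =
      ∑ x, ∑ t ∈ Finset.range (τ x + 1), routeWeight (A t) n (c x t) := by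
  unfold systemWeight
  refine Finset.sum_comm' fun t x => ?_
  have := hτ x
  simp only [Finset.mem_range, Finset.mem_filter, Finset.mem_univ, true_and, and_true]
  omega

variable {n K : ℕ} {τ : ι → ℕ} {pos : ι → ℕ → ℕ} {c : ι → ℕ → ℕ → ℕ}

/-- A measure for the distance of a system of paths from one with top sources and bottom sinks. -/
def systemDefect (n : ℕ) (τ : ι → ℕ) (pos : ι → ℕ → ℕ) : ℕ :=
  ∑ x, (n - pos x 0) + ∑ x, pos x (τ x + 1)

theorem IsRouteSystem.exists_sourceUp {A : ℕ → ℕ → ℕ → TropNum}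
    (hA : ∀ t, t ≤ K → GoodWeights n (A t)) (h : IsRouteSystem n τ pos c) {p : ι}
    (hp : pos p 0 < n) (hfree : ∀ x, pos x 0 ≠ pos p 0 + 1) :
    ∃ pos' c', IsRouteSystem n τ pos' c' ∧ systemWeight A n K τ c ≤ systemWeight A n K τ c' ∧
      systemDefect n τ pos' < systemDefect n τ pos := by
  classical
  obtain ⟨d, d1, d2, d3, d4⟩ := _root_.exists_sourceUp (hA 0 (Nat.zero_le _)) Finset.univ
    (fun x => pos x 0) (fun x => pos x 1) (fun x => c x 0)
    (fun x _ => h.route x 0 (Nat.zero_le _))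
    (fun x _ y _ hxy => h.disj x y 0 hxy (Nat.zero_le _) (Nat.zero_le _)) (Finset.mem_univ p) rfl
    (fun x _ => hfree x) hp
  refine ⟨fun x t => if x = p ∧ t = 0 then pos p 0 + 1 else pos x t,
    fun x t => if t = 0 then d x else c x t, ⟨fun x t ht => ?_, fun x y t hxy hx hy => ?_⟩, ?_, ?_⟩
  · simp only [Nat.add_eq_zero_iff, one_ne_zero, and_false, if_false]
    rcases Nat.eq_zero_or_pos t with rfl | h1
    · simp only [and_true, if_true]
      by_cases h2 : x = p
      · rw [if_pos h2, h2]
        exact d1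
      · rw [if_neg h2]
        exact d2 x (Finset.mem_univ x) h2
    · rw [if_neg (by omega), if_neg (by omega)]
      exact h.route x t ht
  · split_ifs
    · exact d3 x (Finset.mem_univ x) y (Finset.mem_univ y) hxy
    · exact h.disj x y t hxy hx hy
  · refine Finset.sum_le_sum fun t _ => ?_
    rcases Nat.eq_zero_or_pos t with rfl | h1
    · simpa using d4
    · simp only [if_neg h1.ne']
      exact le_rfl
  · refine Nat.add_lt_add_of_lt_of_le (Finset.sum_lt_sum (fun x _ => ?_)
      ⟨p, Finset.mem_univ p, ?_⟩) (Finset.sum_le_sum fun x _ => ?_)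
    · dsimp only
      split_ifs with h1
      · rw [h1.1]
        omega
      · exact le_rfl
    · simp only [and_self, if_true]
      omega
    · simp

theorem IsRouteSystem.exists_sinkDown {A : ℕ → ℕ → ℕ → TropNum}
    (hA : ∀ t, t ≤ K → GoodWeights n (A t)) (hτ : ∀ x, τ x ≤ K) (h : IsRouteSystem n τ pos c)
    {p : ι} {u : ℕ} (hu : 1 ≤ u) (hp : pos p (τ p + 1) = u + 1)
    (hfree : ∀ x, τ p ≤ τ x → pos x (τ p + 1) ≠ u) :
    ∃ pos' c', IsRouteSystem n τ pos' c' ∧ systemWeight A n K τ c ≤ systemWeight A n K τ c' ∧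
      systemDefect n τ pos' < systemDefect n τ pos := by
  classical
  have hr := h.route p (τ p) le_rfl
  rw [hp] at hr
  refine ⟨fun x t => if x = p ∧ t = τ p + 1 then u else pos x t,
    fun x t => if x = p ∧ t = τ p then (fun L => min (c p (τ p) L) u) else c x t,
    ⟨fun x t ht => ?_, fun x y t hxy hx hy => ?_⟩, ?_, ?_⟩
  · by_cases h1 : x = p ∧ t = τ p
    · obtain ⟨rfl, rfl⟩ := h1
      rw [if_neg (by omega), if_pos ⟨rfl, rfl⟩, if_pos ⟨rfl, rfl⟩]
      exact hr.sinkDown hu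
    · have h2 : ¬(x = p ∧ t + 1 = τ p + 1) := fun h2 => h1 ⟨h2.1, by omega⟩
      have h3 : ¬(x = p ∧ t = τ p + 1) := by
        rintro ⟨rfl, h3⟩
        omega
      rw [if_neg h3, if_neg h2, if_neg h1]
      exact h.route x t ht
  · by_cases h1 : x = p ∧ t = τ p
    · obtain ⟨rfl, rfl⟩ := h1
      rw [if_pos ⟨rfl, rfl⟩, if_neg (fun h1 => hxy h1.1.symm)]
      exact RoutesDisjoint.sinkDown hr hu (h.route y _ hy) (h.disj x y _ hxy hx hy) (hfree y hy)
    · rw [if_neg h1]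
      by_cases h2 : y = p ∧ t = τ p
      · obtain ⟨rfl, rfl⟩ := h2
        rw [if_pos ⟨rfl, rfl⟩]
        exact (RoutesDisjoint.sinkDown hr hu (h.route x _ hx) (h.disj y x _ hxy.symm hy hx)
          (hfree x hx)).symm
      · rw [if_neg h2]
        exact h.disj x y t hxy hx hy
  · refine Finset.sum_le_sum fun t ht => Finset.sum_le_sum fun x _ => ?_
    dsimp only
    by_cases h1 : x = p ∧ t = τ p
    · obtain ⟨rfl, rfl⟩ := h1
      rw [if_pos ⟨rfl, rfl⟩]
      exact routeWeight_sinkDown (hA _ (hτ x)) hr hu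
    · rw [if_neg h1]
  · refine Nat.add_lt_add_of_le_of_lt (Finset.sum_le_sum fun x _ => ?_)
      (Finset.sum_lt_sum (fun x _ => ?_) ⟨p, Finset.mem_univ p, ?_⟩)
    · simp
    · dsimp only
      split_ifs with h1
      · rw [h1.1, hp]
        omega
      · exact le_rfl
    · simp only [and_self, if_true]
      omega

/-- The path `p` stops just above a path `q` that continues. Exchanging their parts up to the
network `τ p` lets `p` stop one line lower at no cost; `q` then arrives one line higher, and the
source-up move in the next network makes up for this. -/
theorem IsRouteSystem.exists_swap {A : ℕ → ℕ → ℕ → TropNum}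
    (hA : ∀ t, t ≤ K → GoodWeights n (A t)) (hτ : ∀ x, τ x ≤ K) (h : IsRouteSystem n τ pos c)
    {p q : ι} (hpq : τ p < τ q) (hp : pos p (τ p + 1) = pos q (τ p + 1) + 1) :
    ∃ pos' c', IsRouteSystem n τ pos' c' ∧ systemWeight A n K τ c ≤ systemWeight A n K τ c' ∧
      systemDefect n τ pos' < systemDefect n τ pos := by
  classical
  have hne : q ≠ p := by
    rintro rfl
    omega
  set t := τ p with ht
  have hrp := h.route p t le_rfl
  obtain ⟨d, d1, d2, d3, d4⟩ := _root_.exists_sourceUp (hA (t + 1) (hpq.trans_le (hτ q)))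
    (Finset.univ.filter fun x => t + 1 ≤ τ x)
    (fun x => pos x (t + 1)) (fun x => pos x (t + 1 + 1)) (fun x => c x (t + 1))
    (fun x hx => h.route x _ (Finset.mem_filter.1 hx).2)
    (fun x hx y hy hxy => h.disj x y _ hxy (Finset.mem_filter.1 hx).2 (Finset.mem_filter.1 hy).2)
    (p := q) (Finset.mem_filter.2 ⟨Finset.mem_univ q, hpq⟩) rfl
    -- In the network `t` only `p` reaches this sink, and `p` stops there, so the line is free in
    -- the next network.
    (fun x hx => by
      have hx := (Finset.mem_filter.1 hx).2
      have hxp : x ≠ p := by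
        rintro rfl
        omega
      have := (h.disj x p t hxp (by omega) le_rfl).sink_ne (h.route x t (by omega)) hrp
      omega)
    (by have := hrp.le; have := hrp.le_n; omega)
  let σ : Equiv.Perm ι := Equiv.swap p q
  have hσp : σ p = q := Equiv.swap_apply_left p q
  have hσq : σ q = p := Equiv.swap_apply_right p q
  have hσ : ∀ x, x ≠ p → x ≠ q → σ x = x := fun x h1 h2 => Equiv.swap_apply_of_ne_of_ne h1 h2
  have hσσ : ∀ x, σ (σ x) = x := fun x => by simp [σ]
  have hστ : ∀ x r, r ≤ t → r ≤ τ x → r ≤ τ (σ x) := by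
    intro x r h1 h2
    by_cases h3 : x = p
    · rw [h3, hσp]
      omega
    · by_cases h4 : x = q
      · rw [h4, hσq]
        omega
      · rwa [hσ x h3 h4]
  refine ⟨fun x r => if r ≤ t + 1 then pos (σ x) r else pos x r,
    fun x r => if r ≤ t then c (σ x) r else if r = t + 1 then d x else c x r,
    ⟨fun x r hr => ?_, fun x y r hxy hx hy => ?_⟩, ?_, ?_⟩
  · rcases lt_trichotomy r (t + 1) with h1 | h1 | h1
    · rw [if_pos (by omega), if_pos (by omega), if_pos (by omega)]
      exact h.route _ r (hστ x r (by omega) hr)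
    · subst h1
      rw [if_pos le_rfl, if_neg (by omega), if_neg (by omega), if_pos rfl]
      by_cases h2 : x = q
      · rw [h2, hσq, hp]
        exact d1
      · have h3 : x ≠ p := by
          rintro rfl
          omega
        rw [hσ x h3 h2]
        exact d2 x (Finset.mem_filter.2 ⟨Finset.mem_univ x, hr⟩) h2
    · rw [if_neg (by omega), if_neg (by omega), if_neg (by omega), if_neg (by omega)]
      exact h.route x r hr
  · split_ifs with h1 h2
    · exact h.disj _ _ r (fun h2 => hxy (σ.injective h2)) (hστ x r h1 hx) (hστ y r h1 hy)
    · subst h2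
      exact d3 x (Finset.mem_filter.2 ⟨Finset.mem_univ x, hx⟩) y
        (Finset.mem_filter.2 ⟨Finset.mem_univ y, hy⟩) hxy
    · exact h.disj x y r hxy hx hy
  · refine Finset.sum_le_sum fun r _ => ?_
    by_cases h1 : r ≤ t
    · simp only [if_pos h1]
      -- Up to the network `t` the exchange merely permutes the paths, and both exchanged paths are
      -- present there.
      refine le_of_eq (Finset.sum_equiv σ (fun x => ?_) fun x _ => ?_)
      · simp only [Finset.mem_filter, Finset.mem_univ, true_and]
        refine ⟨hστ x r h1, fun h2 => ?_⟩
        have h3 := hστ _ r h1 h2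
        rwa [hσσ x] at h3
      · rw [hσσ x]
    · simp only [if_neg h1]
      by_cases h2 : r = t + 1
      · subst h2
        simpa only [if_pos] using d4
      · simp only [if_neg h2]
        exact le_rfl
  · refine Nat.add_lt_add_of_le_of_lt (le_of_eq ?_)
      (Finset.sum_lt_sum (fun x _ => ?_) ⟨p, Finset.mem_univ p, ?_⟩)
    · simp only [Nat.zero_le, if_true]
      exact Equiv.sum_comp σ fun x => n - pos x 0
    · dsimp only
      split_ifs with h1
      · by_cases h2 : x = p
        · rw [h2, hσp, ← ht]
          omega
        · rw [hσ x h2 (by rintro rfl; omega)]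
      · exact le_rfl
    · dsimp only
      rw [← ht, if_pos le_rfl, hσp]
      omega

/-- A system of paths can be improved to one whose sources are at the top and whose sinks are at the
bottom. -/
theorem IsRouteSystem.exists_extremal {A : ℕ → ℕ → ℕ → TropNum}
    (hA : ∀ t, t ≤ K → GoodWeights n (A t)) (hτ : ∀ x, τ x ≤ K) (h : IsRouteSystem n τ pos c) :
    ∃ pos' c', IsRouteSystem n τ pos' c' ∧ systemWeight A n K τ c ≤ systemWeight A n K τ c' ∧
      (∀ p, pos' p 0 < n → ∃ x, pos' x 0 = pos' p 0 + 1) ∧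
      ∀ p u, 1 ≤ u → pos' p (τ p + 1) = u + 1 → ∃ x, τ x = τ p ∧ pos' x (τ x + 1) = u := by
  induction hd : systemDefect n τ pos using Nat.strong_induction_on generalizing pos c with
  | _ d ih =>
    have step : (∃ pos' c', IsRouteSystem n τ pos' c' ∧
        systemWeight A n K τ c ≤ systemWeight A n K τ c' ∧
        systemDefect n τ pos' < systemDefect n τ pos) → ∃ pos' c', IsRouteSystem n τ pos' c' ∧
        systemWeight A n K τ c ≤ systemWeight A n K τ c' ∧
        (∀ p, pos' p 0 < n → ∃ x, pos' x 0 = pos' p 0 + 1) ∧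
        ∀ p u, 1 ≤ u → pos' p (τ p + 1) = u + 1 → ∃ x, τ x = τ p ∧ pos' x (τ x + 1) = u := by
      rintro ⟨pos', c', h1, h2, h3⟩
      obtain ⟨pos'', c'', g1, g2, g3⟩ := ih _ (hd ▸ h3) h1 rfl
      exact ⟨pos'', c'', g1, h2.trans g2, g3⟩
    by_cases h1 : ∀ p, pos p 0 < n → ∃ x, pos x 0 = pos p 0 + 1
    · by_cases h2 : ∀ p u, 1 ≤ u → pos p (τ p + 1) = u + 1 →
          ∃ x, τ x = τ p ∧ pos x (τ x + 1) = u
      · exact ⟨pos, c, h, le_rfl, h1, h2⟩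
      · push Not at h2
        obtain ⟨p, u, hu, hp, h3⟩ := h2
        apply step
        -- No path stops at the sink `u` of this network. Either a path passes through it, and the
        -- two are exchanged, or it is unoccupied.
        by_cases h4 : ∃ q, τ p < τ q ∧ pos q (τ p + 1) = u
        · obtain ⟨q, hq, hqu⟩ := h4
          exact h.exists_swap hA hτ hq (by rw [hp, hqu])
        · push Not at h4
          refine h.exists_sinkDown hA hτ hu hp fun x hx => ?_
          rcases hx.lt_or_eq with h5 | h5
          · exact h4 x h5
          · rw [h5]
            exact h3 x h5.symm
    · push Not at h1
      obtain ⟨p, hp, h2⟩ := h1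
      exact step (h.exists_sourceUp hA hp h2)

end RouteSystem

/-! ### Systems of routes and `α`-multipaths. -/

theorem concatMk_eq {n K : ℕ} {s s' : Fin (K + 1)} {z z' : StdV n}
    (h : concatMk s z = concatMk s' z') : (s = s' ∧ z = z') ∨
      ((s : ℕ) + 1 = s' ∧ z.l = z'.l ∧ z.x = 2 * z.l ∧ z'.x = 0) ∨
      ((s' : ℕ) + 1 = s ∧ z.l = z'.l ∧ z'.x = 2 * z'.l ∧ z.x = 0) := by
  have h1 := congrArg (concatCoords n K) h
  rw [concatCoords_mk, concatCoords_mk] at h1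
  split_ifs at h1 with h2 h3 h3 <;> simp only [Prod.mk.injEq] at h1
  · exact Or.inl ⟨Fin.ext (by omega), StdV.ext h1.2.1 (by omega)⟩
  · exact Or.inr (Or.inl ⟨h1.1, h1.2.1, h2.1, h1.2.2.symm⟩)
  · exact Or.inr (Or.inr ⟨h1.1.symm, h1.2.1, h3.1, h1.2.2⟩)
  · exact Or.inl ⟨Fin.ext h1.1, StdV.ext h1.2.1 h1.2.2⟩

section

variable {ι : Type*} {n K : ℕ} {τ : ι → ℕ} {pos : ι → ℕ → ℕ} {c : ι → ℕ → ℕ → ℕ}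

/-- A glued vertex could be met as a sink by one path and as a source by another. The second path
has then come through the same sink of the preceding network, where the two are already disjoint. -/
theorem IsRouteSystem.not_sink_source (h : IsRouteSystem n τ pos c) {x y : ι} (hxy : x ≠ y)
    {s : ℕ} (hx : s ≤ τ x) (hy : s + 1 ≤ τ y) {l : ℕ} (hxl : pos x (s + 1) ≤ l)
    (hxc : 2 * l ≤ 2 * c x s l) (hyl : l ≤ pos y (s + 1))
    (hyc : 2 * c y (s + 1) (l + 1) - 1 ≤ 0) : False := by
  have rx := h.route x s hx
  have ry := h.route y s (by omega)
  have ry' := h.route y (s + 1) hy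
  have h1 := rx.le_low l
  have h2 : pos y (s + 1) < l + 1 := by
    by_contra h2
    have := ry'.pos (l + 1) (by omega)
    omega
  exact (h.disj x y s hxy hx (by omega)).sink_ne rx ry (by omega)

theorem IsRouteSystem.not_onRoutes (h : IsRouteSystem n τ pos c) {x y : ι} (hxy : x ≠ y)
    {v : ConcatV (stdSeq n K)} (hx : OnRoutes (τ x) (pos x) (c x) v)
    (hy : OnRoutes (τ y) (pos y) (c y) v) : False := by
  obtain ⟨s, z, rfl, x1, x2, x3, x4, x5⟩ := hx
  obtain ⟨s', z', h1, y1, y2, y3, y4, y5⟩ := hy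
  rcases concatMk_eq h1 with ⟨rfl, rfl⟩ | ⟨h2, h3, h4, h5⟩ | ⟨h2, h3, h4, h5⟩
  · have vx := ((h.route x s x1).visits_iff z.l).2 ⟨x2, x3⟩
    have vy := ((h.route y s y1).visits_iff z.l).2 ⟨y2, y3⟩
    rcases h.disj x y s hxy x1 y1 z.l vx.1 vx.2 vy.1 vy.2 with h2 | h2 <;> omega
  · rw [← h2] at y1 y2 y3 y4 y5
    rw [h3] at x2 x5 h4
    exact h.not_sink_source hxy x1 y1 x2 (h4 ▸ x5) y3 (h5 ▸ y4)
  · rw [← h2] at x1 x2 x3 x4 x5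
    rw [h3] at x3 x4
    exact h.not_sink_source hxy.symm y1 x1 y2 (h4 ▸ y5) x3 (h5 ▸ x4)

end

section

variable {n K : ℕ} {α : Fin (K + 1) → ℕ}

/-- The number of the last network that the path of index `x` of an `α`-multipath meets. -/
def lastNetwork (x : Σ i, Fin (α i)) : ℕ := x.1

theorem lastNetwork_le (x : Σ i, Fin (α i)) : lastNetwork x ≤ K := Nat.lt_succ_iff.1 x.1.2

/-- The `x`-th path of an `α`-multipath. -/
def Network.TupleMultipath.get {N : Fin (K + 1) → Network n} (q : TupleMultipath N α)
    (x : Σ i, Fin (α i)) : (concatUpTo N x.1).Path :=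
  (q.part x.1).path x.2

theorem Network.TupleMultipath.weight_eq_sum {N : Fin (K + 1) → Network n}
    (q : TupleMultipath N α) (w : ∀ t, (N t).E → TropNum) :
    q.weight w = ∑ x, (q.get x).weight (concatWeight N w x.1) := by
  rw [Fintype.sum_sigma]
  rfl

/-- The vertices of the `x`-th path of an `α`-multipath, as vertices of the whole concatenation. -/
def Network.TupleMultipath.getVerts {N : Fin (K + 1) → Network n} (q : TupleMultipath N α)
    (x : Σ i, Fin (α i)) : Set (ConcatV N) :=
  (q.get x).verts

theorem Network.TupleMultipath.disjoint_getVerts {N : Fin (K + 1) → Network n}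
    (q : TupleMultipath N α) {x y : Σ i, Fin (α i)} (hxy : x ≠ y) :
    Disjoint (q.getVerts x) (q.getVerts y) := by
  obtain ⟨i, r⟩ := x
  obtain ⟨j, s⟩ := y
  by_cases h : i = j
  · subst h
    exact (q.part i).disj r s fun h => hxy (by rw [h])
  · refine (q.disj i j h).mono ?_ ?_
    · exact Set.subset_iUnion (fun r => ((q.part i).path r).verts) r
    · exact Set.subset_iUnion (fun r => ((q.part j).path r).verts) s

/-- Every `α`-multipath is encoded by a system of routes. -/
theorem exists_routeSystem_of_tupleMultipath {w : Fin (K + 1) → StdE n → TropNum}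
    (hw : ∀ t, w t ∈ stdWeightings n) (q : TupleMultipath (stdSeq n K) α) :
    ∃ pos c, IsRouteSystem n (lastNetwork (α := α)) pos c ∧
      q.weight w = systemWeight (concatEntry w) n K lastNetwork c := by
  have hex := fun x : Σ i, Fin (α i) => exists_routes_of_walk hw x.1 (q.get x).last (q.get x).edges
    0 ((stdNetwork n).source (q.get x).first)
    (by change 0 < 2 * ((q.get x).first.1 + 1); omega) (Fin.zero_le _) (q.get x).isWalk
  choose pos c h1 h2 h3 h4 h5 h6 h7 using hex
  have hroute : ∀ x t, t ≤ lastNetwork x → IsRoute n (pos x t) (pos x (t + 1)) (c x t) :=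
    fun x t ht => h3 x t (Nat.zero_le _) ht
  have hverts : ∀ x (s : Fin (K + 1)) (z : StdV n), (s : ℕ) ≤ lastNetwork x →
      pos x (s + 1) ≤ z.l → z.l ≤ pos x s → 2 * c x s (z.l + 1) - 1 ≤ z.x →
      z.x ≤ 2 * c x s z.l → concatMk s z ∈ q.getVerts x :=
    fun x s z k1 k2 k3 k4 k5 =>
      h7 x s z (Fin.zero_le _) k1 k2 k3 (fun _ _ => Nat.zero_le _) k4 k5
  refine ⟨pos, c, ⟨hroute, fun x y t hxy hx hy L x1 x2 y1 y2 => ?_⟩, ?_⟩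
  · have rx := hroute x t hx
    have ry := hroute y t hy
    have vx := (rx.visits_iff L).1 ⟨x1, x2⟩
    have vy := (ry.visits_iff L).1 ⟨y1, y2⟩
    have hxn := rx.le_n
    have hyn := ry.le_n
    by_contra hcon
    push Not at hcon
    have htK : t < K + 1 := Nat.lt_succ_of_le (hx.trans (lastNetwork_le x))
    have hLb := rx.one_le
    have ax := rx.anti (Nat.le_succ L)
    have ay := ry.anti (Nat.le_succ L)
    simp only [Nat.succ_eq_add_one] at ax ay
    -- If the two intervals on line `L` overlap, the larger of their left ends lies in both. On the
    -- top line it is the source `0`, which has the required parity.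
    let z : StdV n := ⟨L, 2 * max (c x t (L + 1)) (c y t (L + 1)) - 1, by omega, by omega, by omega,
      fun hLn => by
        rw [rx.high (L + 1) (by omega), ry.high (L + 1) (by omega)]
        exact Even.zero⟩
    refine Set.disjoint_left.1 (q.disjoint_getVerts hxy)
      (hverts x ⟨t, htK⟩ z hx vx.1 vx.2 ?_ ?_) (hverts y ⟨t, htK⟩ z hy vy.1 vy.2 ?_ ?_)
    all_goals
      simp only [z]
      omega
  · rw [systemWeight_eq_sum lastNetwork_le, q.weight_eq_sum]
    refine Finset.sum_congr rfl fun x _ => (h6 x).trans ?_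
    symm
    refine Finset.sum_subset (Finset.range_subset_range.2 (Nat.succ_le_succ (lastNetwork_le x)))
      fun t _ ht => ?_
    rw [h5 x t (Or.inr (by rw [Finset.mem_range] at ht; exact Nat.lt_of_succ_le (not_lt.1 ht))),
      routeWeight_zero]

/-- Every system of routes encodes an `α`-multipath. -/
theorem exists_tupleMultipath_of_routeSystem {w : Fin (K + 1) → StdE n → TropNum}
    (hw : ∀ t, w t ∈ stdWeightings n) {pos : (Σ i, Fin (α i)) → ℕ → ℕ}
    {c : (Σ i, Fin (α i)) → ℕ → ℕ → ℕ} (h : IsRouteSystem n lastNetwork pos c) :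
    ∃ p : TupleMultipath (stdSeq n K) α,
      p.weight w = systemWeight (concatEntry w) n K lastNetwork c ∧
      (∀ x, ((p.get x).first : ℕ) + 1 = pos x 0) ∧
      ∀ x, ((p.get x).last : ℕ) + 1 = pos x (lastNetwork x + 1) := by
  have hex : ∀ x : Σ i, Fin (α i), ∃ p : (concatUpTo (stdSeq n K) x.1).Path,
      (p.weight (concatWeight (stdSeq n K) w x.1) =
        ∑ t ∈ Finset.range (lastNetwork x + 1), routeWeight (concatEntry w t) n (c x t)) ∧
      (p.first : ℕ) + 1 = pos x 0 ∧ (p.last : ℕ) + 1 = pos x (lastNetwork x + 1) ∧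
      ∀ v ∈ p.verts, OnRoutes (lastNetwork x) (pos x) (c x) v := by
    intro x
    have r0 := h.route x 0 (Nat.zero_le _)
    have r1 := h.route x _ le_rfl
    have l0 := r0.le
    have l1 := r0.one_le
    have l2 := r0.le_n
    have l3 := r1.one_le
    have l4 := r1.le
    have l5 := r1.le_n
    let a : Fin n := ⟨pos x 0 - 1, by omega⟩
    let b : Fin n := ⟨pos x (lastNetwork x + 1) - 1, by omega⟩
    have ha : (a : ℕ) + 1 = pos x 0 := by simp only [a]; omega
    have hb : (b : ℕ) + 1 = pos x (lastNetwork x + 1) := by simp only [b]; omega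
    obtain ⟨es, g1, g2, g3⟩ := exists_walk_of_routes hw x.1 (pos x) (c x) (h.route x) b hb.symm
      x.1 0 (Nat.zero_add _) ((stdNetwork n).source a) ha rfl
    refine ⟨⟨a, b, es, g1⟩, ?_, ha, hb, ?_⟩
    · rw [Finset.range_eq_Ico]
      exact g2
    · rintro v (rfl | ⟨e, he, rfl⟩)
      · refine ⟨0, (stdNetwork n).source a, rfl, Nat.zero_le _, ?_, ha.le, ?_, Nat.zero_le _⟩
        · exact l0.trans ha.ge
        · change 2 * c x 0 (a + 1 + 1) - 1 ≤ 0
          rw [r0.high _ (by omega)]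
      · exact g3 e he
  choose p h1 h2 h3 h4 using hex
  have hdisj : ∀ x y, x ≠ y → Disjoint (α := Set (ConcatV (stdSeq n K))) (p x).verts (p y).verts :=
    fun x y hxy => Set.disjoint_left.2 fun v hx hy => h.not_onRoutes hxy (h4 x v hx) (h4 y v hy)
  refine ⟨⟨fun i => ⟨fun r => p ⟨i, r⟩, fun r s hrs => hdisj _ _ fun h => hrs ?_⟩,
    fun i j hij => ?_⟩, ?_, h2, h3⟩
  · simpa using h
  · refine Set.disjoint_iUnion_left.2 fun r => Set.disjoint_iUnion_right.2 fun s => ?_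
    exact hdisj _ _ fun h => hij (congrArg Sigma.fst h)
  · rw [TupleMultipath.weight_eq_sum, systemWeight_eq_sum lastNetwork_le]
    exact Finset.sum_congr rfl fun x _ => h1 x

end

/-! ### Existence of a heaviest extremal system. -/

theorem Finset.eq_Icc_of_succ_mem {n : ℕ} {P : Finset ℕ} (hP : P ⊆ Finset.Icc 1 n)
    (h : ∀ x ∈ P, x < n → x + 1 ∈ P) : P = Finset.Icc (n - P.card + 1) n := by
  rcases P.eq_empty_or_nonempty with rfl | hne
  · simp
  have hm := P.min'_mem hne
  have h1 := Finset.mem_Icc.1 (hP hm)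
  have h2 : P = Finset.Icc (P.min' hne) n := by
    apply Finset.Subset.antisymm
    · exact fun x hx => Finset.mem_Icc.2 ⟨P.min'_le x hx, (Finset.mem_Icc.1 (hP hx)).2⟩
    · intro x hx
      rw [Finset.mem_Icc] at hx
      obtain ⟨hx1, hx2⟩ := hx
      induction x, hx1 using Nat.le_induction with
      | base => exact hm
      | succ x _ ih => exact h x (ih (by omega)) (by omega)
  have h3 := congrArg Finset.card h2
  rw [Nat.card_Icc] at h3
  rw [show n - P.card + 1 = P.min' hne by omega]
  exact h2

theorem Finset.eq_Icc_of_pred_mem {n : ℕ} {P : Finset ℕ} (hP : P ⊆ Finset.Icc 1 n)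
    (h : ∀ x, 1 ≤ x → x + 1 ∈ P → x ∈ P) : P = Finset.Icc 1 P.card := by
  rcases P.eq_empty_or_nonempty with rfl | hne
  · simp
  have hm := P.max'_mem hne
  have h2 : P = Finset.Icc 1 (P.max' hne) := by
    apply Finset.Subset.antisymm
    · exact fun x hx => Finset.mem_Icc.2 ⟨(Finset.mem_Icc.1 (hP hx)).1, P.le_max' x hx⟩
    · intro x hx
      rw [Finset.mem_Icc] at hx
      obtain ⟨hx1, hx2⟩ := hx
      induction hx2 using Nat.decreasingInduction with
      | self => exact hm
      | of_succ x _ ih => exact h x hx1 (ih (by omega))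
  have h3 := congrArg Finset.card h2
  rw [Nat.card_Icc] at h3
  rw [show P.card = P.max' hne by omega]
  exact h2

theorem multiGZ_stdSeq {n K : ℕ} {w : Fin (K + 1) → StdE n → TropNum}
    (hw : ∀ t, w t ∈ stdWeightings n) (hA : ∀ t, GoodWeights n (stdEntry (w t))) :
    MultiGZ (stdSeq n K) w := by
  classical
  intro α hα
  have hA' : ∀ t, t ≤ K → GoodWeights n (concatEntry w t) := fun t ht => by
    have := hA ⟨t, by omega⟩
    rwa [← concatEntry_val] at this
  have hcard : Fintype.card (Σ i, Fin (α i)) = ∑ i, α i := by simp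
  let Extremal := fun pos c => IsRouteSystem n (lastNetwork (α := α)) pos c ∧
    (∀ p, pos p 0 < n → ∃ x, pos x 0 = pos p 0 + 1) ∧
    ∀ p u, 1 ≤ u → pos p (lastNetwork p + 1) = u + 1 →
      ∃ x, lastNetwork x = lastNetwork p ∧ pos x (lastNetwork x + 1) = u
  let W := fun c => systemWeight (concatEntry w) n K (lastNetwork (α := α)) c
  have himp : ∀ pos c, IsRouteSystem n (lastNetwork (α := α)) pos c →
      ∃ pos' c', Extremal pos' c' ∧ W c ≤ W c' := by
    intro pos c h
    obtain ⟨pos', c', h1, h2, h3⟩ := h.exists_extremal hA' lastNetwork_le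
    exact ⟨pos', c', ⟨h1, h3⟩, h2⟩
  let S : Set TropNum := {m | ∃ pos c, Extremal pos c ∧ W c = m}
  -- The weight depends only on columns on the lines `1, …, n` of finitely many networks, and these
  -- columns are at most `n`.
  have hSfin : S.Finite := by
    let F : ((Σ i, Fin (α i)) → Fin (K + 1) → Fin (n + 1) → Fin (n + 1)) → TropNum := fun f =>
      ∑ t : Fin (K + 1), ∑ x with t ≤ lastNetwork x,
        ∑ L ∈ Finset.Icc 1 n, concatEntry w t L (f x t (Fin.ofNat (n + 1) L))
    refine (Set.finite_range F).subset ?_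
    rintro _ ⟨pos, c, h, rfl⟩
    refine ⟨fun x t L => Fin.ofNat (n + 1) (c x t L), ?_⟩
    simp only [F, W, systemWeight]
    rw [Finset.sum_range]
    refine Finset.sum_congr rfl fun t _ => Finset.sum_congr rfl fun x hx =>
      Finset.sum_congr rfl fun L hL => ?_
    have r := h.1.route x t (Finset.mem_filter.1 hx).2
    rw [Finset.mem_Icc] at hL
    have h1 : L % (n + 1) = L := Nat.mod_eq_of_lt (by omega)
    have h2 : c x t L % (n + 1) = c x t L :=
      Nat.mod_eq_of_lt (by have := r.le_low L; have := r.le; have := r.le_n; omega)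
    simp only [Fin.ofNat, h1, h2]
  have hSne : S.Nonempty := by
    -- Since `∑ α i ≤ n`, the paths can be placed on distinct lines and run horizontally; this gives
    -- a first system to improve.
    obtain ⟨e⟩ : Nonempty ((Σ i, Fin (α i)) ↪ Fin n) :=
      Function.Embedding.nonempty_of_card_le (by rw [hcard, Fintype.card_fin]; exact hα)
    have h0 : IsRouteSystem n (lastNetwork (α := α)) (fun x _ => e x + 1)
        (fun x _ => constRoute (e x + 1)) := by
      refine ⟨fun x t _ => isRoute_constRoute (by omega) (by omega),
        fun x y t hxy _ _ L x1 x2 y1 y2 => ?_⟩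
      have hne : (e x : ℕ) ≠ e y := fun h => hxy (e.injective (Fin.ext h))
      unfold constRoute at x1 x2 y1 y2
      split_ifs at x1 x2 y1 y2 <;> omega
    obtain ⟨pos, c, h, -⟩ := himp _ _ h0
    exact ⟨_, pos, c, h, rfl⟩
  obtain ⟨m, ⟨pos, c, ⟨hsys, hsrc, hsnk⟩, rfl⟩, hmax⟩ := hSfin.exists_maximal hSne
  obtain ⟨p, hpw, hpf, hpl⟩ := exists_tupleMultipath_of_routeSystem hw hsys
  have hinj : Function.Injective fun x => pos x 0 := fun x y hxy => by
    by_contra hne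
    exact (hsys.disj x y 0 hne (Nat.zero_le _) (Nat.zero_le _)).source_ne
      (hsys.route x 0 (Nat.zero_le _)) (hsys.route y 0 (Nat.zero_le _)) hxy
  refine ⟨p, ?_, fun i => ?_, fun q => ?_⟩
  · have hP := Finset.eq_Icc_of_succ_mem (n := n) (P := Finset.univ.image fun x => pos x 0)
      (by
        intro a ha
        obtain ⟨x, -, rfl⟩ := Finset.mem_image.1 ha
        have r := hsys.route x 0 (Nat.zero_le _)
        exact Finset.mem_Icc.2 ⟨r.one_le.trans r.le, r.le_n⟩)
      (by
        intro a ha han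
        obtain ⟨x, -, rfl⟩ := Finset.mem_image.1 ha
        obtain ⟨y, hy⟩ := hsrc x han
        exact Finset.mem_image.2 ⟨y, Finset.mem_univ y, hy⟩)
    rw [Finset.card_image_of_injective _ hinj, Finset.card_univ, hcard] at hP
    ext a
    have ha : ((a : ℕ) + 1 ∈ Finset.univ.image fun x => pos x 0) ↔
        n - ∑ i, α i + 1 ≤ (a : ℕ) + 1 := by
      rw [hP, Finset.mem_Icc]
      have := a.2
      omega
    rw [Set.mem_ofPred_eq, ← ha]
    simp only [TupleMultipath.sources, Multipath.sources, Set.mem_iUnion, Set.mem_range,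
      Finset.mem_image, Finset.mem_univ, true_and]
    constructor
    · rintro ⟨i, r, rfl⟩
      exact ⟨⟨i, r⟩, (hpf ⟨i, r⟩).symm⟩
    · rintro ⟨⟨i, r⟩, h⟩
      exact ⟨i, r, Fin.ext (Nat.succ_injective ((hpf ⟨i, r⟩).trans h))⟩
  · have hinj' : Function.Injective fun r : Fin (α i) => pos ⟨i, r⟩ (i + 1) := fun r s hrs => by
      by_contra hne
      have hne' : (⟨i, r⟩ : Σ i, Fin (α i)) ≠ ⟨i, s⟩ := fun h => hne (by simpa using h)
      exact (hsys.disj _ _ i hne' le_rfl le_rfl).sink_ne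
        (hsys.route ⟨i, r⟩ i le_rfl) (hsys.route ⟨i, s⟩ i le_rfl) hrs
    have hP := Finset.eq_Icc_of_pred_mem (n := n)
      (P := Finset.univ.image fun r : Fin (α i) => pos ⟨i, r⟩ (i + 1))
      (by
        intro a ha
        obtain ⟨x, -, rfl⟩ := Finset.mem_image.1 ha
        have r := hsys.route ⟨i, x⟩ i le_rfl
        exact Finset.mem_Icc.2 ⟨r.one_le, r.le.trans r.le_n⟩)
      (by
        intro a ha1 ha
        obtain ⟨r, -, hr⟩ := Finset.mem_image.1 ha
        obtain ⟨⟨j, s⟩, h1, h2⟩ := hsnk ⟨i, r⟩ a ha1 hr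
        obtain rfl : j = i := Fin.ext h1
        exact Finset.mem_image.2 ⟨s, Finset.mem_univ s, h2⟩)
    rw [Finset.card_image_of_injective _ hinj', Finset.card_univ, Fintype.card_fin] at hP
    ext a
    have ha : ((a : ℕ) + 1 ∈ Finset.univ.image fun r : Fin (α i) => pos ⟨i, r⟩ (i + 1)) ↔
        (a : ℕ) + 1 ≤ α i := by
      rw [hP, Finset.mem_Icc]
      omega
    rw [Set.mem_ofPred_eq, ← ha]
    simp only [Multipath.sinks, Set.mem_range, Finset.mem_image, Finset.mem_univ, true_and]
    constructor
    · rintro ⟨r, rfl⟩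
      exact ⟨r, (hpl ⟨i, r⟩).symm⟩
    · rintro ⟨r, h⟩
      exact ⟨r, Fin.ext (Nat.succ_injective ((hpl ⟨i, r⟩).trans h))⟩
  -- An arbitrary multipath is dominated by an extremal system, hence by the heaviest one.
  · obtain ⟨pos', c', h1, h2⟩ := exists_routeSystem_of_tupleMultipath hw q
    obtain ⟨pos'', c'', h3, h4⟩ := himp pos' c' h1
    rw [h2, hpw]
    refine h4.trans ?_
    rcases le_total (W c'') (W c) with h5 | h5
    · exact h5
    · exact hmax ⟨pos'', c'', h3, rfl⟩ h5

theorem mainTheorem10 (n k : ℕ) (w : Fin k → (stdNetwork n).E → TropNum)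
    (hw : ∀ t, w t ∈ stdWeightings n)
    (hGZ : ∀ t, IsGelfandZeitlin (w t))
    (hsink : ∀ t (l : ℕ) (h1 : 1 ≤ l) (hl : l + 1 ≤ n),
      w t (sinkEdge n l h1 (by omega)) = ⊥ → w t (sinkEdge n (l + 1) (by omega) hl) = ⊥)
    (i j : Fin k) (hij : i ≤ j) :
    Network.MultiGZ (k := (j : ℕ) - i) (fun _ => stdNetwork n)
      (fun t => w ⟨i + t, by omega⟩) :=
  multiGZ_stdSeq (fun _ => hw _) fun _ => goodWeights_stdEntry (hw _) (hGZ _) fun l h1 hl => by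
    rw [stdEntry_self _ l h1 (by omega), stdEntry_self _ (l + 1) (by omega) hl]
    exact hsink _ l h1 hl
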